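/- For a positive integer $d$, let $Q_d$ denote the $d$-dimensional hypercube: its vertices are the binary words of length $d$, two of them being adjacent if and only if they differ at exactly one position. For an integer $k\ge 3$, the sunlet graph $L_{2k}$ of order $2k$ is the graph obtained from a cycle of length $k$ by attaching one pendant edge (with a new end vertex) to each vertex of the cycle. For graphs $G$ and $H$, an $H$-decomposition of $G$ is a collection of pairwise edge-disjoint subgraphs of $G$, each isomorphic to $H$, whose edge sets partition the edge set of $G$. Let $m\ge 2$ be an integer and let $n\ge 4$ be an even integer. Then: 1. $Q_{mn}$ has an $L_{2^{t+1}}$-decomposition for every integer $t$ with $2\le t\le n-1$. 2. $Q_{mn}$ has an $L_{2n}$-decomposition. 3. $Q_{mn}$ has an $L_{4n}$-decomposition. 4. $Q_{mn}$ has an $L_{8n}$-decomposition. 5. $Q_{mn}$ has an $L_{n2^{k+1}}$-decomposition for every integer $k$ with $2n\le n2^k\le \dfrac{2^n}{n}$. -/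

import Mathlib

/-- The hypercube `Q_n`: vertices are binary words of length `n`, two of which are adjacent
when they differ at exactly one position. -/
def hypercube (n : ℕ) : SimpleGraph (Fin n → Bool) where
  Adj x y := ∃! i, x i ≠ y i
  symm := ⟨fun _ _ ⟨i, hi, hu⟩ => ⟨i, hi.symm, fun j hj => hu j hj.symm⟩⟩
  loopless := ⟨fun _ ⟨_, hi, _⟩ => hi rfl⟩

/-- The sunlet graph `L_{2k}` of order `2k` (for `k ≥ 3`): the cycle `C_k` on the vertices
`Sum.inl i`, together with one pendant edge joining `Sum.inl i` to the new vertex `Sum.inr i`,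
for every `i`. -/
def sunletGraph (k : ℕ) : SimpleGraph (Fin k ⊕ Fin k) where
  Adj
    | Sum.inl i, Sum.inl j => (SimpleGraph.cycleGraph k).Adj i j
    | Sum.inl i, Sum.inr j => i = j
    | Sum.inr i, Sum.inl j => i = j
    | Sum.inr _, Sum.inr _ => False
  symm := ⟨by
    rintro (i | i) (j | j) h
    · exact SimpleGraph.Adj.symm h
    · exact Eq.symm h
    · exact Eq.symm h
    · exact h⟩
  loopless := ⟨by
    rintro (i | i) h
    · exact SimpleGraph.irrefl _ h
    · exact h⟩

/-- `G` has an `H`-decomposition: there is a collection of pairwise edge-disjoint subgraphs of `G`,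
each isomorphic to `H`, whose edge sets together make up the edge set of `G`. -/
def HasDecomposition {V W : Type*} (G : SimpleGraph V) (H : SimpleGraph W) : Prop :=
  ∃ D : Set G.Subgraph,
    (∀ S ∈ D, Nonempty (S.coe ≃g H)) ∧
    (D.Pairwise fun S T => Disjoint S.edgeSet T.edgeSet) ∧
    (⋃ S ∈ D, S.edgeSet) = G.edgeSet

/-! A sunlet has as many pendant edges as cycle edges, so a decomposition can be encoded by a
permutation of states: a state is a cycle vertex with its next cycle edge and its pendant edge. If
every edge of the cube is named exactly once and the orbits trace sunlets, the orbits are the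
decomposition (`hasDecomposition_of_orbits`).

Cycle lengths `n * 2 ^ k` with `k ≤ n`. Suppose `Q_a` splits into oriented cycles of length `L` with
`t` of them through each vertex. In `Q_a × Q_a` the edges leaving a vertex of one copy serve as
pendant edges for the cycles of the other (`CycleSystem.attach`). In `Q_a × Q_t`, over even words of
`Q_t` the cycles through a vertex receive one direction of `Q_t` each, and over odd words a sunlet
decomposition of `Q_a` is used (`CycleSystem.layer`). As every `m ≥ 2` is a sum of twos and threes,
dimensions `2 * n` and `3 * n` suffice. The cycles come from a rotor walk on `w` two-letter blocks.
It visits the blocks cyclically and follows an oriented square in each. The orientations are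
reversed in every second round, so a double round undoes itself, except that the first `K` blocks
may be complemented; these act as a binary counter and stretch the period to `2 * w * 2 ^ K`. For
even `w ≥ 4`, every second state keeps its cycle edge and takes the edge of the skipped state at the
same word as pendant edge, which gives sunlets in `Q_{2w}` itself.

Cycle lengths `2 ^ t`. The product of two cycles of length `Q` splits, for `M ∣ Q`, into two
2-factors with cycles of length `M * Q`: one walk takes one step in the first direction for every `M
- 1` in the second, and the other walk makes the opposite choice everywhere. For `M < Q` the second
factor provides pendant edges for the first, since each of its edges shifts by `±M` an invariant of
the first in `ZMod Q`. Repeated splitting factors cubes of 2-power dimension. The remaining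
coordinates are absorbed by orienting their cube so that outgoing edges come in pairs: where a pair
is present, both 2-factors of the torus become sunlet cycles and the pair supplies their pendant
edges (`torusSunlets`). -/

/-! ### Sunlets as orbits of a permutation of states -/

/-- Adjacency in a cycle graph, through successors modulo the length. -/
theorem cycleGraph_adj_iff_mod {L : ℕ} (hL : 3 ≤ L) (u v : Fin L) :
    (SimpleGraph.cycleGraph L).Adj u v ↔
      v.val = (u.val + 1) % L ∨ u.val = (v.val + 1) % L := by
  rw [SimpleGraph.cycleGraph_adj']
  have key : ∀ a b : Fin L, (a - b).val = 1 ↔ a.val = (b.val + 1) % L := by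
    intro a b
    have ha := a.isLt
    have hb := b.isLt
    rw [Fin.sub_def]
    simp only
    rcases Nat.lt_or_ge (b.val + 1) L with h | h
    · rw [Nat.mod_eq_of_lt h]
      rcases Nat.lt_or_ge a.val b.val with h' | h'
      · rw [Nat.mod_eq_of_lt (by omega)]; omega
      · rw [show L - b.val + a.val = (a.val - b.val) + L by omega, Nat.add_mod_right,
          Nat.mod_eq_of_lt (by omega)]
        omega
    · rw [show b.val + 1 = L by omega, Nat.mod_self]
      rcases Nat.lt_or_ge (L - b.val + a.val) L with h' | h'
      · rw [Nat.mod_eq_of_lt h']; omega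
      · rw [show L - b.val + a.val = (a.val + L - b.val - L) + L by omega, Nat.add_mod_right,
          Nat.mod_eq_of_lt (by omega)]
        omega
  rw [key, key, or_comm]

theorem iterate_mod_period {Ω : Type*} {next : Ω → Ω} {L : ℕ} {ω : Ω} (h : next^[L] ω = ω)
    (m : ℕ) : next^[m % L] ω = next^[m] ω := by
  conv_rhs => rw [← Nat.mod_add_div m L, Function.iterate_add_apply, Function.iterate_mul]
  congr 1
  exact (Function.iterate_fixed h _).symm

/-- An assertion about two different iterates below the period reduces to one iterate. -/
theorem iterate_ne_of_lt {Ω X : Type*} {next : Ω → Ω} {L : ℕ} (f : Ω → X)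
    (h : ∀ ω m, 0 < m → m < L → f (next^[m] ω) ≠ f ω) (ω : Ω) {i j : ℕ} (hi : i < L) (hj : j < L)
    (hij : f (next^[i] ω) = f (next^[j] ω)) : i = j := by
  rcases lt_trichotomy i j with hlt | heq | hlt
  · refine absurd ?_ (h (next^[i] ω) (j - i) (by omega) (by omega))
    rw [← Function.iterate_add_apply, show j - i + i = j by omega, hij]
  · exact heq
  · refine absurd ?_ (h (next^[j] ω) (i - j) (by omega) (by omega))
    rw [← Function.iterate_add_apply, show i - j + j = i by omega, hij]

section Criterion

variable {V Ω : Type*} (G : SimpleGraph V) (L : ℕ) (next : Ω → Ω) (pos pend : Ω → V)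

/-- The sunlet traced by the orbit of a state. -/
def orbitCopy (hL : 3 ≤ L) (hcyc : ∀ ω, next^[L] ω = ω)
    (hadj : ∀ ω, G.Adj (pos ω) (pos (next ω))) (hpadj : ∀ ω, G.Adj (pos ω) (pend ω))
    (hsimple : ∀ ω m, 0 < m → m < L → pos (next^[m] ω) ≠ pos ω)
    (hpend : ∀ ω m, pos (next^[m] ω) ≠ pend ω)
    (hpp : ∀ ω m, 0 < m → m < L → pend (next^[m] ω) ≠ pend ω) (ω : Ω) :
    SimpleGraph.Copy (sunletGraph L) G where
  toHom :=
    { toFun := Sum.elim (fun i => pos (next^[i.val] ω)) (fun i => pend (next^[i.val] ω))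
      map_rel' := by
        have step : ∀ a b : Fin L, b.val = (a.val + 1) % L →
            G.Adj (pos (next^[a.val] ω)) (pos (next^[b.val] ω)) := by
          intro a b hab
          rw [hab, iterate_mod_period (hcyc ω), Function.iterate_succ_apply']
          exact hadj _
        rintro (a | a) (b | b) h
        · rcases (cycleGraph_adj_iff_mod hL a b).1 h with h | h
          · exact step a b h
          · exact (step b a h).symm
        · obtain rfl : a = b := h
          exact hpadj _
        · obtain rfl : a = b := h
          exact (hpadj _).symm
        · exact h.elim }
  injective' := by
    have off : ∀ i j : Fin L, pos (next^[i.val] ω) ≠ pend (next^[j.val] ω) := by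
      intro i j h
      -- The hypothesis only looks forward along the orbit, so position `i` is reached from state
      -- `j` by going once around.
      refine hpend (next^[j.val] ω) (i.val + (L - j.val)) ?_
      rw [← Function.iterate_add_apply, show i.val + (L - j.val) + j.val = i.val + L by omega,
        Function.iterate_add_apply, hcyc, h]
    rintro (a | a) (b | b) h
    · exact congrArg _ (Fin.ext (iterate_ne_of_lt pos hsimple ω a.isLt b.isLt h))
    · exact absurd h (off a b)
    · exact absurd h.symm (off b a)
    · exact congrArg _ (Fin.ext (iterate_ne_of_lt pend hpp ω a.isLt b.isLt h))

/-- A graph decomposes into sunlets when it carries a permutation of states, with a cycle edge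
and a pendant edge at every state, that uses every edge once and whose orbits trace sunlets. -/
theorem hasDecomposition_of_orbits (hL : 3 ≤ L) (hcyc : ∀ ω, next^[L] ω = ω)
    (hadj : ∀ ω, G.Adj (pos ω) (pos (next ω))) (hpadj : ∀ ω, G.Adj (pos ω) (pend ω))
    (hsimple : ∀ ω m, 0 < m → m < L → pos (next^[m] ω) ≠ pos ω)
    (hpend : ∀ ω m, pos (next^[m] ω) ≠ pend ω)
    (hpp : ∀ ω m, 0 < m → m < L → pend (next^[m] ω) ≠ pend ω)
    (hcover : ∀ e ∈ G.edgeSet, ∃! q : Ω ⊕ Ω, Sum.elim (fun ω => s(pos ω, pos (next ω)))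
      (fun ω => s(pos ω, pend ω)) q = e) :
    HasDecomposition G (sunletGraph L) := by
  set E : Ω ⊕ Ω → Sym2 V :=
    Sum.elim (fun ω => s(pos ω, pos (next ω))) (fun ω => s(pos ω, pend ω)) with hE
  set C := orbitCopy G L next pos pend hL hcyc hadj hpadj hsimple hpend hpp with hC
  have hedge : ∀ ω e, e ∈ (C ω).toSubgraph.edgeSet ↔
      ∃ m, E (Sum.inl (next^[m] ω)) = e ∨ E (Sum.inr (next^[m] ω)) = e := by
    intro ω e
    rw [SimpleGraph.Copy.toSubgraph, SimpleGraph.Subgraph.edgeSet_map]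
    constructor
    · rintro ⟨e', he', rfl⟩
      induction e' using Sym2.inductionOn with
      | _ x y =>
        have hxy : (sunletGraph L).Adj x y := he'
        have step : ∀ a b : Fin L, b.val = (a.val + 1) % L →
            E (Sum.inl (next^[a.val] ω)) = s(pos (next^[a.val] ω), pos (next^[b.val] ω)) := by
          intro a b hab
          rw [hab, iterate_mod_period (hcyc ω), Function.iterate_succ_apply']
          rfl
        rcases x with a | a <;> rcases y with b | b
        · rcases (cycleGraph_adj_iff_mod hL a b).1 hxy with h | h
          · exact ⟨a, Or.inl (step a b h)⟩
          · exact ⟨b, Or.inl ((step b a h).trans Sym2.eq_swap)⟩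
        · obtain rfl : a = b := hxy
          exact ⟨a, Or.inr rfl⟩
        · obtain rfl : a = b := hxy
          exact ⟨a, Or.inr Sym2.eq_swap⟩
        · exact hxy.elim
    · rintro ⟨m, h⟩
      have hm : m % L < L := Nat.mod_lt _ (by omega)
      have hm' : (m + 1) % L < L := Nat.mod_lt _ (by omega)
      rcases h with rfl | rfl
      · refine ⟨s(Sum.inl ⟨m % L, hm⟩, Sum.inl ⟨(m + 1) % L, hm'⟩), ?_, ?_⟩
        · exact (cycleGraph_adj_iff_mod hL _ _).2 (Or.inl (by simp))
        · change s(pos (next^[m % L] ω), pos (next^[(m + 1) % L] ω)) = _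
          rw [iterate_mod_period (hcyc ω), iterate_mod_period (hcyc ω),
            Function.iterate_succ_apply']
          rfl
      · refine ⟨s(Sum.inl ⟨m % L, hm⟩, Sum.inr ⟨m % L, hm⟩), ?_, ?_⟩
        · exact (rfl : (⟨m % L, hm⟩ : Fin L) = ⟨m % L, hm⟩)
        · change s(pos (next^[m % L] ω), pend (next^[m % L] ω)) = _
          rw [iterate_mod_period (hcyc ω)]
          rfl
  have hmem : ∀ q, E q ∈ G.edgeSet := by
    rintro (ω | ω)
    · exact hadj ω
    · exact hpadj ω
  have hinj : ∀ p q, E p = E q → p = q := fun p q h =>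
    (hcover (E q) (hmem q)).unique h rfl
  -- Its classes are the orbits; one sunlet is taken per orbit, traced from a chosen representative.
  let r : Setoid Ω :=
    { r := fun x y => ∃ a b, next^[a] x = next^[b] y
      iseqv :=
        { refl := fun x => ⟨0, 0, rfl⟩
          symm := fun ⟨a, b, h⟩ => ⟨b, a, h.symm⟩
          trans := by
            rintro x y z ⟨a, b, h⟩ ⟨c, d, h'⟩
            refine ⟨c + a, b + d, ?_⟩
            rw [Function.iterate_add_apply, h, ← Function.iterate_add_apply, Nat.add_comm,
              Function.iterate_add_apply, h', ← Function.iterate_add_apply] } }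
  refine ⟨Set.range fun c : Quotient r => (C c.out).toSubgraph, ?_, ?_, ?_⟩
  · rintro _ ⟨c, rfl⟩
    exact ⟨(C c.out).isoToSubgraph.symm⟩
  · rintro _ ⟨c, rfl⟩ _ ⟨c', rfl⟩ hne
    rw [Set.disjoint_left]
    intro e he he'
    apply hne
    obtain ⟨m, hm⟩ := (hedge _ _).1 he
    obtain ⟨m', hm'⟩ := (hedge _ _).1 he'
    have : next^[m] c.out = next^[m'] c'.out := by
      rcases hm with hm | hm <;> rcases hm' with hm' | hm' <;>
        have := hinj _ _ (hm.trans hm'.symm)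
      · exact Sum.inl.inj this
      · cases this
      · cases this
      · exact Sum.inr.inj this
    have hcc : c = c' := by
      rw [← Quotient.out_eq c, ← Quotient.out_eq c']
      exact Quotient.sound ⟨m, m', this⟩
    subst hcc
    rfl
  · apply Set.Subset.antisymm
    · refine Set.iUnion₂_subset fun S _ => S.edgeSet_subset
    · intro e he
      obtain ⟨q, hq, -⟩ := hcover e he
      have key : ∀ ω, ∃ m, next^[m] (Quotient.mk r ω).out = ω := by
        intro ω
        obtain ⟨a, b, h⟩ : ∃ a b, next^[a] (Quotient.mk r ω).out = next^[b] ω :=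
          Quotient.exact (Quotient.out_eq (Quotient.mk r ω))
        -- The extra `b * L - b` steps undo the `b` steps on the other side, as `next^[L]` is the
        -- identity.
        refine ⟨b * L - b + a, ?_⟩
        rw [Function.iterate_add_apply, h, ← Function.iterate_add_apply,
          Nat.sub_add_cancel (Nat.le_mul_of_pos_right b (by omega)), Nat.mul_comm,
          Function.iterate_mul]
        exact Function.iterate_fixed (hcyc ω) _
      rw [Set.mem_iUnion₂]
      rcases q with ω | ω
      · obtain ⟨m, hm⟩ := key ω
        exact ⟨_, ⟨Quotient.mk r ω, rfl⟩, (hedge _ _).2 ⟨m, Or.inl (by rw [hm]; exact hq)⟩⟩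
      · obtain ⟨m, hm⟩ := key ω
        exact ⟨_, ⟨Quotient.mk r ω, rfl⟩, (hedge _ _).2 ⟨m, Or.inr (by rw [hm]; exact hq)⟩⟩

end Criterion

/-! ### Cube moves, cycle systems and sunlet systems -/

/-- Flipping one coordinate of a binary word. -/
def cubeStep (ι : Type) [DecidableEq ι] (i : ι) (x : ι → Bool) : ι → Bool :=
  Function.update x i (!x i)

theorem cubeStep_apply {ι : Type} [DecidableEq ι] (i j : ι) (x : ι → Bool) :
    cubeStep ι i x j = if j = i then !x j else x j := by
  unfold cubeStep
  by_cases h : j = i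
  · subst h; simp
  · simp [h]

theorem cubeStep_ne {ι : Type} [DecidableEq ι] (i : ι) (x : ι → Bool) : cubeStep ι i x ≠ x := by
  intro h
  have := congrFun h i
  simp [cubeStep_apply] at this

theorem cubeStep_cubeStep {ι : Type} [DecidableEq ι] (i : ι) (x : ι → Bool) :
    cubeStep ι i (cubeStep ι i x) = x := by
  ext j
  by_cases h : j = i <;> simp [cubeStep_apply, h]

theorem cubeStep_injective {ι : Type} [DecidableEq ι] (x : ι → Bool) :
    Function.Injective fun i => cubeStep ι i x := by
  intro i j h
  have := congrFun h i
  by_contra hne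
  simp [cubeStep_apply, hne] at this

/-- The moves of a product: a label moves the factor it belongs to. -/
def prodStep {V W ι κ : Type} (s : ι → V → V) (t : κ → W → W) : ι ⊕ κ → V × W → V × W
  | Sum.inl i, x => (s i x.1, x.2)
  | Sum.inr j, x => (x.1, t j x.2)

/-- A decomposition of the graph with moves `s` into closed walks of length `L` with distinct
vertices, such that the walks through a vertex are indexed by `T`. -/
structure CycleSystem {V ι : Type} (s : ι → V → V) (T : Type) (L : ℕ) where
  dir : V × T → ι
  next : V × T → V × T
  next_fst : ∀ ω, (next ω).1 = s (dir ω) ω.1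
  iterate_next : ∀ ω, next^[L] ω = ω
  simple : ∀ ω m, 0 < m → m < L → (next^[m] ω).1 ≠ ω.1
  cover : ∀ v i, ∃! ω : V × T, dir ω = i ∧ (ω.1 = v ∨ ω.1 = s i v)

/-- A decomposition of the graph with moves `s` into sunlets with cycles of length `L`, as a
permutation of states; a state is a cycle vertex with its next cycle edge and its pendant edge. -/
structure SunletSystem {V ι : Type} (s : ι → V → V) (L : ℕ) where
  State : Type
  pos : State → V
  next : State → State
  dir : State → ι
  out : State → ι
  pos_next : ∀ ω, pos (next ω) = s (dir ω) (pos ω)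
  iterate_next : ∀ ω, next^[L] ω = ω
  simple : ∀ ω m, 0 < m → m < L → pos (next^[m] ω) ≠ pos ω
  out_not_mem : ∀ ω m, pos (next^[m] ω) ≠ s (out ω) (pos ω)
  out_simple : ∀ ω m, 0 < m → m < L →
    s (out (next^[m] ω)) (pos (next^[m] ω)) ≠ s (out ω) (pos ω)
  cover : ∀ v i, ∃! q : State ⊕ State, Sum.elim dir out q = i ∧
    (Sum.elim pos pos q = v ∨ Sum.elim pos pos q = s i v)

theorem hypercube_adj_iff {d : ℕ} (x y : Fin d → Bool) :
    (hypercube d).Adj x y ↔ ∃ i, y = cubeStep (Fin d) i x := by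
  constructor
  · rintro ⟨i, hi, hu⟩
    refine ⟨i, funext fun j => ?_⟩
    rw [cubeStep_apply]
    split_ifs with h
    · subst h
      cases hx : x j <;> cases hy : y j <;> simp_all
    · by_contra hne
      exact h (hu j fun h' => hne h'.symm)
  · rintro ⟨i, rfl⟩
    refine ⟨i, by simp [cubeStep_apply], fun j hj => ?_⟩
    by_contra h
    simp [cubeStep_apply, h] at hj

/-- An edge of the cube is the same as a direction with one of two ends, so the field `cover` says
that every edge is used exactly once. -/
theorem SunletSystem.hasDecomposition {d L : ℕ} (S : SunletSystem (cubeStep (Fin d)) L)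
    (hL : 3 ≤ L) : HasDecomposition (hypercube d) (sunletGraph L) := by
  refine hasDecomposition_of_orbits _ L S.next S.pos (fun ω => cubeStep _ (S.out ω) (S.pos ω)) hL
    S.iterate_next (fun ω => (hypercube_adj_iff _ _).2 ⟨_, S.pos_next ω⟩)
    (fun ω => (hypercube_adj_iff _ _).2 ⟨_, rfl⟩) S.simple S.out_not_mem S.out_simple ?_
  have key : ∀ (p x : Fin d → Bool) (i j : Fin d),
      s(p, cubeStep _ j p) = s(x, cubeStep _ i x) ↔ j = i ∧ (p = x ∨ p = cubeStep _ i x) := by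
    intro p x i j
    rw [Sym2.eq_iff]
    constructor
    · rintro (⟨rfl, h⟩ | ⟨rfl, h⟩)
      · exact ⟨cubeStep_injective _ h, Or.inl rfl⟩
      · have h' : cubeStep _ j (cubeStep _ i x) = cubeStep _ i (cubeStep _ i x) := by
          rw [h, cubeStep_cubeStep]
        exact ⟨cubeStep_injective _ h', Or.inr rfl⟩
    · rintro ⟨rfl, rfl | rfl⟩
      · exact Or.inl ⟨rfl, rfl⟩
      · exact Or.inr ⟨rfl, cubeStep_cubeStep _ _⟩
  intro e he
  induction e using Sym2.inductionOn with
  | _ x y =>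
    obtain ⟨i, rfl⟩ := (hypercube_adj_iff x y).1 he
    have hiff : ∀ q : S.State ⊕ S.State,
        Sum.elim (fun ω => s(S.pos ω, S.pos (S.next ω)))
          (fun ω => s(S.pos ω, cubeStep _ (S.out ω) (S.pos ω))) q = s(x, cubeStep _ i x) ↔
        (Sum.elim S.dir S.out q = i ∧
          (Sum.elim S.pos S.pos q = x ∨ Sum.elim S.pos S.pos q = cubeStep _ i x)) := by
      rintro (ω | ω)
      · simp only [Sum.elim_inl, S.pos_next]
        exact key _ _ _ _
      · simp only [Sum.elim_inr]
        exact key _ _ _ _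
    simp only [hiff]
    exact S.cover x i

/-! ### Transport along renamings of vertices and moves -/

theorem existsUnique_map {X X' : Type} (g : X ≃ X') {p : X → Prop} {p' : X' → Prop}
    (hp : ∀ x, p x ↔ p' (g x)) (hx : ∃! x, p x) : ∃! x, p' x := by
  obtain ⟨x, hx, hu⟩ := hx
  refine ⟨g x, (hp x).1 hx, fun y hy => ?_⟩
  rw [← hu (g.symm y) ((hp _).2 (by simpa using hy))]
  simp

section Transport

variable {V V' ι ι' : Type} {s : ι → V → V} {s' : ι' → V' → V'}

theorem equiv_step_eq_iff {e : V ≃ V'} {f : ι ≃ ι'} (h : ∀ i v, e (s i v) = s' (f i) (e v))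
    (v w : V) (i : ι) : (w = v ∨ w = s i v) ↔ (e w = e v ∨ e w = s' (f i) (e v)) := by
  rw [← h, e.apply_eq_iff_eq, e.apply_eq_iff_eq]

/-- Renaming vertices, moves and indices in a cycle system. -/
def CycleSystem.map {T T' : Type} {L : ℕ} (C : CycleSystem s T L) (e : V ≃ V') (f : ι ≃ ι')
    (g : T ≃ T') (h : ∀ i v, e (s i v) = s' (f i) (e v)) : CycleSystem s' T' L where
  dir ω := f (C.dir ((e.prodCongr g).symm ω))
  next := (e.prodCongr g) ∘ C.next ∘ (e.prodCongr g).symm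
  next_fst ω := by
    obtain ⟨ω, rfl⟩ := (e.prodCongr g).surjective ω
    simp only [Function.comp_apply, Equiv.symm_apply_apply]
    change e (C.next ω).1 = s' _ (e ω.1)
    rw [C.next_fst, h]
  iterate_next ω := by
    obtain ⟨ω, rfl⟩ := (e.prodCongr g).surjective ω
    rw [(Function.Semiconj.iterate_right (f := e.prodCongr g) (ga := C.next)
      (fun x => by rw [Function.comp_apply, Function.comp_apply, Equiv.symm_apply_apply]) L).eq ω
      |>.symm, C.iterate_next]
  simple ω m hm hm' := by
    obtain ⟨ω, rfl⟩ := (e.prodCongr g).surjective ω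
    rw [(Function.Semiconj.iterate_right (f := e.prodCongr g) (ga := C.next)
      (fun x => by rw [Function.comp_apply, Function.comp_apply, Equiv.symm_apply_apply]) m).eq ω
      |>.symm]
    exact fun h' => C.simple ω m hm hm' (e.injective h')
  cover v i := by
    obtain ⟨v, rfl⟩ := e.surjective v
    obtain ⟨i, rfl⟩ := f.surjective i
    refine existsUnique_map (e.prodCongr g) (fun ω => ?_) (C.cover v i)
    simp only [Equiv.symm_apply_apply, f.apply_eq_iff_eq]
    rw [equiv_step_eq_iff h]
    rfl

/-- Renaming vertices and moves in a sunlet system. -/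
def SunletSystem.map {L : ℕ} (S : SunletSystem s L) (e : V ≃ V') (f : ι ≃ ι')
    (h : ∀ i v, e (s i v) = s' (f i) (e v)) : SunletSystem s' L where
  State := S.State
  pos ω := e (S.pos ω)
  next := S.next
  dir ω := f (S.dir ω)
  out ω := f (S.out ω)
  pos_next ω := by rw [S.pos_next, h]
  iterate_next := S.iterate_next
  simple ω m hm hm' h' := S.simple ω m hm hm' (e.injective h')
  out_not_mem ω m h' := S.out_not_mem ω m (e.injective (by rw [h', h]))
  out_simple ω m hm hm' h' := S.out_simple ω m hm hm' (e.injective (by rw [h, h, h']))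
  cover v i := by
    obtain ⟨v, rfl⟩ := e.surjective v
    obtain ⟨i, rfl⟩ := f.surjective i
    refine existsUnique_map (Equiv.refl _) (fun q => ?_) (S.cover v i)
    rw [equiv_step_eq_iff h]
    rcases q with ω | ω <;> simp

end Transport

theorem cubeStep_arrowCongr {ι κ : Type} [DecidableEq ι] [DecidableEq κ] (f : ι ≃ κ) (i : ι)
    (v : ι → Bool) : f.arrowCongr (Equiv.refl Bool) (cubeStep ι i v) =
      cubeStep κ (f i) (f.arrowCongr (Equiv.refl Bool) v) := by
  ext j
  simp [cubeStep_apply, Equiv.arrowCongr, Equiv.symm_apply_eq]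

theorem cubeStep_sumArrow {ι κ : Type} [DecidableEq ι] [DecidableEq κ] (i : ι ⊕ κ)
    (v : (ι → Bool) × (κ → Bool)) :
    (Equiv.sumArrowEquivProdArrow ι κ Bool).symm (prodStep (cubeStep ι) (cubeStep κ) i v) =
      cubeStep (ι ⊕ κ) i ((Equiv.sumArrowEquivProdArrow ι κ Bool).symm v) := by
  ext j
  rcases i with i | i <;> rcases j with j | j <;>
    simp [cubeStep_apply, prodStep, Equiv.sumArrowEquivProdArrow]

/-- The cube of dimension `d` splits into cycles of length `L`, with `t` of them at each vertex. -/
def HasCycles (L d t : ℕ) : Prop := Nonempty (CycleSystem (cubeStep (Fin d)) (Fin t) L)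

/-- The cube of dimension `d` splits into sunlets with cycles of length `L`. -/
def HasSunlets (L d : ℕ) : Prop := Nonempty (SunletSystem (cubeStep (Fin d)) L)

theorem HasCycles.of_system {ι T : Type} [Fintype ι] [DecidableEq ι] [Fintype T] {L d t : ℕ}
    (C : CycleSystem (cubeStep ι) T L) (hd : Fintype.card ι = d) (ht : Fintype.card T = t) :
    HasCycles L d t :=
  ⟨C.map _ (Fintype.equivFinOfCardEq hd) (Fintype.equivFinOfCardEq ht) (cubeStep_arrowCongr _)⟩

theorem HasSunlets.of_system {ι : Type} [Fintype ι] [DecidableEq ι] {L d : ℕ}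
    (S : SunletSystem (cubeStep ι) L) (hd : Fintype.card ι = d) : HasSunlets L d :=
  ⟨S.map _ (Fintype.equivFinOfCardEq hd) (cubeStep_arrowCongr _)⟩

theorem HasCycles.of_prod {ι κ T : Type} [Fintype ι] [DecidableEq ι] [Fintype κ] [DecidableEq κ]
    [Fintype T] {L d t : ℕ} (C : CycleSystem (prodStep (cubeStep ι) (cubeStep κ)) T L)
    (hd : Fintype.card ι + Fintype.card κ = d) (ht : Fintype.card T = t) : HasCycles L d t :=
  .of_system (C.map _ (Equiv.refl _) (Equiv.refl _) cubeStep_sumArrow)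
    (by rw [Fintype.card_sum, hd]) ht

theorem HasSunlets.of_prod {ι κ : Type} [Fintype ι] [DecidableEq ι] [Fintype κ] [DecidableEq κ]
    {L d : ℕ} (S : SunletSystem (prodStep (cubeStep ι) (cubeStep κ)) L)
    (hd : Fintype.card ι + Fintype.card κ = d) : HasSunlets L d :=
  .of_system (S.map _ (Equiv.refl _) cubeStep_sumArrow) (by rw [Fintype.card_sum, hd])

/-! ### Constructions in products of graphs -/

/-- A map intertwining two self-maps intertwines their iterates. -/
theorem iterate_semiconj {X Y : Type} {φ : X → Y} {f : X → X} {g : Y → Y}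
    (h : ∀ x, φ (f x) = g (φ x)) (m : ℕ) (x : X) : g^[m] (φ x) = φ (f^[m] x) :=
  ((Function.Semiconj.iterate_right (f := φ) h m).eq x).symm

section Combinations

variable {V W ι κ T T' : Type} {s : ι → V → V} {t : κ → W → W} {L : ℕ}

/-- The successor map on the states of a product of cycle systems. -/
def prodNext (f : V × T → V × T) (g : W × T' → W × T') :
    (V × W) × (T ⊕ T') → (V × W) × (T ⊕ T')
  | ((v, w), Sum.inl τ) => (((f (v, τ)).1, w), Sum.inl (f (v, τ)).2)
  | ((v, w), Sum.inr τ) => ((v, (g (w, τ)).1), Sum.inr (g (w, τ)).2)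

theorem prodNext_iterate_inl (f : V × T → V × T) (g : W × T' → W × T') (m : ℕ) (v : V) (w : W)
    (τ : T) : (prodNext f g)^[m] ((v, w), Sum.inl τ) =
      (((f^[m] (v, τ)).1, w), Sum.inl (f^[m] (v, τ)).2) :=
  iterate_semiconj (φ := fun ω : V × T => ((ω.1, w), (Sum.inl ω.2 : T ⊕ T')))
    (g := prodNext f g) (fun _ => rfl) m (v, τ)

theorem prodNext_iterate_inr (f : V × T → V × T) (g : W × T' → W × T') (m : ℕ) (v : V) (w : W)
    (τ : T') : (prodNext f g)^[m] ((v, w), Sum.inr τ) =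
      ((v, (g^[m] (w, τ)).1), Sum.inr (g^[m] (w, τ)).2) :=
  iterate_semiconj (φ := fun ω : W × T' => ((v, ω.1), (Sum.inr ω.2 : T ⊕ T')))
    (g := prodNext f g) (fun _ => rfl) m (w, τ)

/-- Cycle systems of two graphs, side by side in the product. -/
def CycleSystem.prod (C : CycleSystem s T L) (D : CycleSystem t T' L) :
    CycleSystem (prodStep s t) (T ⊕ T') L where
  dir
    | ((v, _), Sum.inl τ) => Sum.inl (C.dir (v, τ))
    | ((_, w), Sum.inr τ) => Sum.inr (D.dir (w, τ))
  next := prodNext C.next D.next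
  next_fst := by
    rintro ⟨⟨v, w⟩, τ | τ⟩
    · exact Prod.ext (C.next_fst _) rfl
    · exact Prod.ext rfl (D.next_fst _)
  iterate_next := by
    rintro ⟨⟨v, w⟩, τ | τ⟩
    · rw [prodNext_iterate_inl, C.iterate_next]
    · rw [prodNext_iterate_inr, D.iterate_next]
  simple := by
    rintro ⟨⟨v, w⟩, τ | τ⟩ m hm hm' h
    · rw [prodNext_iterate_inl] at h
      exact C.simple (v, τ) m hm hm' (congrArg Prod.fst h :)
    · rw [prodNext_iterate_inr] at h
      exact D.simple (w, τ) m hm hm' (congrArg Prod.snd h :)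
  cover := by
    rintro ⟨v, w⟩ (i | i)
    · obtain ⟨⟨v', τ⟩, ⟨h1, h2⟩, hu⟩ := C.cover v i
      refine ⟨((v', w), Sum.inl τ), ⟨congrArg Sum.inl h1, ?_⟩, ?_⟩
      · exact h2.imp (fun h => Prod.ext h rfl) (fun h => Prod.ext h rfl)
      · rintro ⟨⟨v'', w'⟩, τ' | τ'⟩ ⟨h3, h4⟩
        · have := hu (v'', τ') ⟨Sum.inl.inj h3,
            h4.imp (fun h => congrArg Prod.fst h) (fun h => congrArg Prod.fst h)⟩
          have hw : w' = w := h4.elim (fun h => congrArg Prod.snd h) (fun h => congrArg Prod.snd h)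
          rw [Prod.mk.injEq] at this
          rw [this.1, this.2, hw]
        · cases h3
    · obtain ⟨⟨w', τ⟩, ⟨h1, h2⟩, hu⟩ := D.cover w i
      refine ⟨((v, w'), Sum.inr τ), ⟨congrArg Sum.inr h1, ?_⟩, ?_⟩
      · exact h2.imp (fun h => Prod.ext rfl h) (fun h => Prod.ext rfl h)
      · rintro ⟨⟨v', w''⟩, τ' | τ'⟩ ⟨h3, h4⟩
        · cases h3
        · have := hu (w'', τ') ⟨Sum.inr.inj h3,
            h4.imp (fun h => congrArg Prod.snd h) (fun h => congrArg Prod.snd h)⟩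
          have hv : v' = v := h4.elim (fun h => congrArg Prod.fst h) (fun h => congrArg Prod.fst h)
          rw [Prod.mk.injEq] at this
          rw [this.1, this.2, hv]

/-- Sunlet systems of two graphs, side by side in the product. -/
def SunletSystem.prod (S : SunletSystem s L) (R : SunletSystem t L) :
    SunletSystem (prodStep s t) L where
  State := S.State × W ⊕ V × R.State
  pos := Sum.elim (Prod.map S.pos id) (Prod.map id R.pos)
  next := Sum.map (Prod.map S.next id) (Prod.map id R.next)
  dir := Sum.elim (fun ω => Sum.inl (S.dir ω.1)) (fun ω => Sum.inr (R.dir ω.2))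
  out := Sum.elim (fun ω => Sum.inl (S.out ω.1)) (fun ω => Sum.inr (R.out ω.2))
  pos_next := by
    rintro (⟨ω, w⟩ | ⟨v, ω⟩)
    · exact Prod.ext (S.pos_next ω) rfl
    · exact Prod.ext rfl (R.pos_next ω)
  iterate_next := by
    rintro (⟨ω, w⟩ | ⟨v, ω⟩)
    · rw [iterate_semiconj (φ := fun ω => Sum.inl (ω, w)) (f := S.next) (fun _ => rfl) L ω,
        S.iterate_next]
    · rw [iterate_semiconj (φ := fun ω => Sum.inr (v, ω)) (f := R.next) (fun _ => rfl) L ω,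
        R.iterate_next]
  simple := by
    rintro (⟨ω, w⟩ | ⟨v, ω⟩) m hm hm' h
    · rw [iterate_semiconj (φ := fun ω => Sum.inl (ω, w)) (f := S.next) (fun _ => rfl) m ω] at h
      exact S.simple ω m hm hm' (congrArg Prod.fst h)
    · rw [iterate_semiconj (φ := fun ω => Sum.inr (v, ω)) (f := R.next) (fun _ => rfl) m ω] at h
      exact R.simple ω m hm hm' (congrArg Prod.snd h)
  out_not_mem := by
    rintro (⟨ω, w⟩ | ⟨v, ω⟩) m h
    · rw [iterate_semiconj (φ := fun ω => Sum.inl (ω, w)) (f := S.next) (fun _ => rfl) m ω] at h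
      exact S.out_not_mem ω m (congrArg Prod.fst h)
    · rw [iterate_semiconj (φ := fun ω => Sum.inr (v, ω)) (f := R.next) (fun _ => rfl) m ω] at h
      exact R.out_not_mem ω m (congrArg Prod.snd h)
  out_simple := by
    rintro (⟨ω, w⟩ | ⟨v, ω⟩) m hm hm' h
    · rw [iterate_semiconj (φ := fun ω => Sum.inl (ω, w)) (f := S.next) (fun _ => rfl) m ω] at h
      exact S.out_simple ω m hm hm' (congrArg Prod.fst h)
    · rw [iterate_semiconj (φ := fun ω => Sum.inr (v, ω)) (f := R.next) (fun _ => rfl) m ω] at h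
      exact R.out_simple ω m hm hm' (congrArg Prod.snd h)
  cover := by
    rintro ⟨v, w⟩ (i | i)
    · obtain ⟨q, ⟨h1, h2⟩, hu⟩ := S.cover v i
      refine ⟨Sum.map (fun ω => Sum.inl (ω, w)) (fun ω => Sum.inl (ω, w)) q, ?_, ?_⟩
      · rcases q with q | q
        · exact ⟨congrArg Sum.inl h1, h2.imp (fun h => Prod.ext h rfl) (fun h => Prod.ext h rfl)⟩
        · exact ⟨congrArg Sum.inl h1, h2.imp (fun h => Prod.ext h rfl) (fun h => Prod.ext h rfl)⟩
      · rintro ((⟨ω, w'⟩ | ⟨v', ω⟩) | (⟨ω, w'⟩ | ⟨v', ω⟩)) ⟨h3, h4⟩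
        · obtain rfl : w' = w :=
            h4.elim (fun h => congrArg Prod.snd h) (fun h => congrArg Prod.snd h)
          rw [← hu (Sum.inl ω) ⟨Sum.inl.inj h3,
            h4.imp (fun h => congrArg Prod.fst h) (fun h => congrArg Prod.fst h)⟩]
          rfl
        · cases h3
        · obtain rfl : w' = w :=
            h4.elim (fun h => congrArg Prod.snd h) (fun h => congrArg Prod.snd h)
          rw [← hu (Sum.inr ω) ⟨Sum.inl.inj h3,
            h4.imp (fun h => congrArg Prod.fst h) (fun h => congrArg Prod.fst h)⟩]
          rfl
        · cases h3
    · obtain ⟨q, ⟨h1, h2⟩, hu⟩ := R.cover w i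
      refine ⟨Sum.map (fun ω => Sum.inr (v, ω)) (fun ω => Sum.inr (v, ω)) q, ?_, ?_⟩
      · rcases q with q | q
        · exact ⟨congrArg Sum.inr h1, h2.imp (fun h => Prod.ext rfl h) (fun h => Prod.ext rfl h)⟩
        · exact ⟨congrArg Sum.inr h1, h2.imp (fun h => Prod.ext rfl h) (fun h => Prod.ext rfl h)⟩
      · rintro ((⟨ω, w'⟩ | ⟨v', ω⟩) | (⟨ω, w'⟩ | ⟨v', ω⟩)) ⟨h3, h4⟩
        · cases h3
        · obtain rfl : v' = v :=
            h4.elim (fun h => congrArg Prod.fst h) (fun h => congrArg Prod.fst h)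
          rw [← hu (Sum.inl ω) ⟨Sum.inr.inj h3,
            h4.imp (fun h => congrArg Prod.snd h) (fun h => congrArg Prod.snd h)⟩]
          rfl
        · cases h3
        · obtain rfl : v' = v :=
            h4.elim (fun h => congrArg Prod.fst h) (fun h => congrArg Prod.fst h)
          rw [← hu (Sum.inr ω) ⟨Sum.inr.inj h3,
            h4.imp (fun h => congrArg Prod.snd h) (fun h => congrArg Prod.snd h)⟩]
          rfl

/-- The cycles of one factor, with pendant edges along the cycles of the other factor. -/
def CycleSystem.attach {L' : ℕ} (C : CycleSystem s T L) (D : CycleSystem t T L')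
    (ht : ∀ i w, t i w ≠ w) : SunletSystem (prodStep s t) L where
  State := (V × T) × W
  pos ω := (ω.1.1, ω.2)
  next := Prod.map C.next id
  dir ω := Sum.inl (C.dir ω.1)
  out ω := Sum.inr (D.dir (ω.2, ω.1.2))
  pos_next ω := Prod.ext (C.next_fst ω.1) rfl
  iterate_next ω := by
    rw [Prod.map_iterate, Function.iterate_id]
    exact Prod.ext (C.iterate_next _) rfl
  simple ω m hm hm' h := by
    rw [Prod.map_iterate, Function.iterate_id] at h
    exact C.simple ω.1 m hm hm' (congrArg Prod.fst h :)
  out_not_mem ω m h := by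
    rw [Prod.map_iterate, Function.iterate_id] at h
    exact ht _ _ (congrArg Prod.snd h).symm
  out_simple ω m hm hm' h := by
    rw [Prod.map_iterate, Function.iterate_id] at h
    exact C.simple ω.1 m hm hm' (congrArg Prod.fst h :)
  cover := by
    rintro ⟨v, w⟩ (i | i)
    · obtain ⟨ω, ⟨h1, h2⟩, hu⟩ := C.cover v i
      refine ⟨Sum.inl (ω, w), ⟨congrArg Sum.inl h1,
        h2.imp (fun h => Prod.ext h rfl) (fun h => Prod.ext h rfl)⟩, ?_⟩
      rintro (⟨ω', w'⟩ | ω') ⟨h3, h4⟩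
      · obtain rfl : w' = w :=
          h4.elim (fun h => congrArg Prod.snd h) (fun h => congrArg Prod.snd h)
        rw [hu ω' ⟨Sum.inl.inj h3,
          h4.imp (fun h => congrArg Prod.fst h) (fun h => congrArg Prod.fst h)⟩]
      · cases h3
    · obtain ⟨ω, ⟨h1, h2⟩, hu⟩ := D.cover w i
      refine ⟨Sum.inr ((v, ω.2), ω.1), ⟨congrArg Sum.inr h1,
        h2.imp (fun h => Prod.ext rfl h) (fun h => Prod.ext rfl h)⟩, ?_⟩
      rintro (ω' | ⟨⟨v', τ⟩, w'⟩) ⟨h3, h4⟩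
      · cases h3
      · obtain rfl : v' = v :=
          h4.elim (fun h => congrArg Prod.fst h) (fun h => congrArg Prod.fst h)
        rw [← hu (w', τ) ⟨Sum.inr.inj h3,
          h4.imp (fun h => congrArg Prod.snd h) (fun h => congrArg Prod.snd h)⟩]

/-- The parity of a binary word. -/
def parity {ι : Type} [Fintype ι] (x : ι → Bool) : ZMod 2 := ∑ i, if x i then 1 else 0

theorem parity_cubeStep {ι : Type} [Fintype ι] [DecidableEq ι] (i : ι) (x : ι → Bool) :
    parity (cubeStep ι i x) = parity x + 1 := by
  unfold parity
  rw [← Finset.add_sum_erase _ _ (Finset.mem_univ i),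
    ← Finset.add_sum_erase _ _ (Finset.mem_univ i),
    Finset.sum_congr rfl (g := fun j => if x j then (1 : ZMod 2) else 0)]
  · cases hx : x i
    · simp [cubeStep_apply, hx, add_comm]
    · simp only [cubeStep_apply, hx, if_true, Bool.not_true, Bool.false_eq_true, if_false]
      rw [add_right_comm, show (1 : ZMod 2) + 1 = 0 from rfl]
  · intro j hj
    simp [cubeStep_apply, (Finset.mem_erase.1 hj).1]

theorem zmod_two_cases (a : ZMod 2) : a = 0 ∨ a = 1 := by
  fin_cases a
  · exact Or.inl rfl
  · exact Or.inr rfl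

/-- Over the even words of a cube the cycles of a cycle system, with pendant edges in the cube;
over its odd words the sunlets of a sunlet system. -/
def CycleSystem.layer [Fintype T] [DecidableEq T] (C : CycleSystem s T L) (S : SunletSystem s L) :
    SunletSystem (prodStep s (cubeStep T)) L where
  State := (V × T) × {z : T → Bool // parity z = 0} ⊕ S.State × {z : T → Bool // parity z = 1}
  pos := Sum.elim (fun ω => (ω.1.1, ω.2.1)) (fun ω => (S.pos ω.1, ω.2.1))
  next := Sum.map (Prod.map C.next id) (Prod.map S.next id)
  dir := Sum.elim (fun ω => Sum.inl (C.dir ω.1)) (fun ω => Sum.inl (S.dir ω.1))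
  out := Sum.elim (fun ω => Sum.inr ω.1.2) (fun ω => Sum.inl (S.out ω.1))
  pos_next := by
    rintro (ω | ω)
    · exact Prod.ext (C.next_fst ω.1) rfl
    · exact Prod.ext (S.pos_next ω.1) rfl
  iterate_next := by
    rintro (⟨ω, z⟩ | ⟨ω, z⟩)
    · rw [iterate_semiconj (φ := fun ω => Sum.inl (ω, z)) (f := C.next) (fun _ => rfl) L ω,
        C.iterate_next]
    · rw [iterate_semiconj (φ := fun ω => Sum.inr (ω, z)) (f := S.next) (fun _ => rfl) L ω,
        S.iterate_next]
  simple := by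
    rintro (⟨ω, z⟩ | ⟨ω, z⟩) m hm hm' h
    · rw [iterate_semiconj (φ := fun ω => Sum.inl (ω, z)) (f := C.next) (fun _ => rfl) m ω] at h
      exact C.simple ω m hm hm' (congrArg Prod.fst h :)
    · rw [iterate_semiconj (φ := fun ω => Sum.inr (ω, z)) (f := S.next) (fun _ => rfl) m ω] at h
      exact S.simple ω m hm hm' (congrArg Prod.fst h)
  out_not_mem := by
    rintro (⟨ω, z⟩ | ⟨ω, z⟩) m h
    · rw [iterate_semiconj (φ := fun ω => Sum.inl (ω, z)) (f := C.next) (fun _ => rfl) m ω] at h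
      exact cubeStep_ne _ _ (congrArg Prod.snd h).symm
    · rw [iterate_semiconj (φ := fun ω => Sum.inr (ω, z)) (f := S.next) (fun _ => rfl) m ω] at h
      exact S.out_not_mem ω m (congrArg Prod.fst h)
  out_simple := by
    rintro (⟨ω, z⟩ | ⟨ω, z⟩) m hm hm' h
    · rw [iterate_semiconj (φ := fun ω => Sum.inl (ω, z)) (f := C.next) (fun _ => rfl) m ω] at h
      exact C.simple ω m hm hm' (congrArg Prod.fst h :)
    · rw [iterate_semiconj (φ := fun ω => Sum.inr (ω, z)) (f := S.next) (fun _ => rfl) m ω] at h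
      exact S.out_simple ω m hm hm' (congrArg Prod.fst h)
  cover := by
    rintro ⟨v, z⟩ (i | τ)
    · rcases zmod_two_cases (parity z) with hz | hz
      · obtain ⟨ω, ⟨h1, h2⟩, hu⟩ := C.cover v i
        refine ⟨Sum.inl (Sum.inl (ω, ⟨z, hz⟩)), ⟨congrArg Sum.inl h1,
          h2.imp (fun h => Prod.ext h rfl) (fun h => Prod.ext h rfl)⟩, ?_⟩
        rintro ((⟨ω', z'⟩ | ⟨ω', z'⟩) | (⟨ω', z'⟩ | ⟨ω', z'⟩)) ⟨h3, h4⟩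
        · obtain rfl : z' = ⟨z, hz⟩ := Subtype.ext
            (h4.elim (fun h => congrArg Prod.snd h) (fun h => congrArg Prod.snd h))
          rw [hu ω' ⟨Sum.inl.inj h3,
            h4.imp (fun h => congrArg Prod.fst h) (fun h => congrArg Prod.fst h)⟩]
        · have : z'.1 = z := h4.elim (fun h => congrArg Prod.snd h) (fun h => congrArg Prod.snd h)
          rw [← this, z'.2] at hz
          cases hz
        · cases h3
        · have : z'.1 = z := h4.elim (fun h => congrArg Prod.snd h) (fun h => congrArg Prod.snd h)
          rw [← this, z'.2] at hz
          cases hz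
      · obtain ⟨q, ⟨h1, h2⟩, hu⟩ := S.cover v i
        refine ⟨Sum.map (fun ω => Sum.inr (ω, ⟨z, hz⟩)) (fun ω => Sum.inr (ω, ⟨z, hz⟩)) q,
          ?_, ?_⟩
        · rcases q with q | q
          · exact ⟨congrArg Sum.inl h1, h2.imp (fun h => Prod.ext h rfl) (fun h => Prod.ext h rfl)⟩
          · exact ⟨congrArg Sum.inl h1, h2.imp (fun h => Prod.ext h rfl) (fun h => Prod.ext h rfl)⟩
        · rintro ((⟨ω', z'⟩ | ⟨ω', z'⟩) | (⟨ω', z'⟩ | ⟨ω', z'⟩)) ⟨h3, h4⟩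
          · have : z'.1 = z := h4.elim (fun h => congrArg Prod.snd h) (fun h => congrArg Prod.snd h)
            rw [← this, z'.2] at hz
            cases hz
          · obtain rfl : z' = ⟨z, hz⟩ := Subtype.ext
              (h4.elim (fun h => congrArg Prod.snd h) (fun h => congrArg Prod.snd h))
            rw [← hu (Sum.inl ω') ⟨Sum.inl.inj h3,
              h4.imp (fun h => congrArg Prod.fst h) (fun h => congrArg Prod.fst h)⟩]
            rfl
          · cases h3
          · obtain rfl : z' = ⟨z, hz⟩ := Subtype.ext
              (h4.elim (fun h => congrArg Prod.snd h) (fun h => congrArg Prod.snd h))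
            rw [← hu (Sum.inr ω') ⟨Sum.inl.inj h3,
              h4.imp (fun h => congrArg Prod.fst h) (fun h => congrArg Prod.fst h)⟩]
            rfl
    -- Every edge of the second cube has exactly one even end, and it is the pendant edge of the
    -- state sitting there.
    · have hex : ∃ z' : {z : T → Bool // parity z = 0}, z'.1 = z ∨ z'.1 = cubeStep T τ z := by
        rcases zmod_two_cases (parity z) with hz | hz
        · exact ⟨⟨z, hz⟩, Or.inl rfl⟩
        · exact ⟨⟨cubeStep T τ z, by rw [parity_cubeStep, hz]; rfl⟩, Or.inr rfl⟩
      obtain ⟨z', hz'⟩ := hex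
      refine ⟨Sum.inr (Sum.inl ((v, τ), z')), ⟨rfl,
        hz'.imp (fun h => Prod.ext rfl h) (fun h => Prod.ext rfl h)⟩, ?_⟩
      rintro ((⟨ω', z''⟩ | ⟨ω', z''⟩) | (⟨⟨v', τ'⟩, z''⟩ | ⟨ω', z''⟩)) ⟨h3, h4⟩
      · cases h3
      · cases h3
      · obtain rfl : τ' = τ := Sum.inr.inj h3
        obtain rfl : v' = v :=
          h4.elim (fun h => congrArg Prod.fst h) (fun h => congrArg Prod.fst h)
        have h5 : z''.1 = z ∨ z''.1 = cubeStep T τ' z :=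
          h4.imp (fun h => congrArg Prod.snd h) (fun h => congrArg Prod.snd h)
        have : z'' = z' := by
          apply Subtype.ext
          have p1 := z'.2
          have p2 := z''.2
          rcases hz' with h | h <;> rcases h5 with h' | h'
          · rw [h, h']
          · rw [h'] at p2; rw [h] at p1
            rw [parity_cubeStep, p1] at p2; cases p2
          · rw [h] at p1; rw [h'] at p2
            rw [parity_cubeStep, p2] at p1; cases p1
          · rw [h, h']
        rw [this]
      · cases h3

end Combinations

/-! ### Combining dimensions -/

theorem HasCycles.add {L a b t t' : ℕ} : HasCycles L a t → HasCycles L b t' →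
    HasCycles L (a + b) (t + t') :=
  fun ⟨C⟩ ⟨D⟩ => .of_prod (C.prod D) (by simp) (by simp)

theorem HasSunlets.add {L a b : ℕ} : HasSunlets L a → HasSunlets L b → HasSunlets L (a + b) :=
  fun ⟨S⟩ ⟨R⟩ => .of_prod (S.prod R) (by simp)

theorem HasCycles.hasSunlets_add_self {L a t : ℕ} : HasCycles L a t → HasSunlets L (a + a) :=
  fun ⟨C⟩ => .of_prod (C.attach C cubeStep_ne) (by simp)

theorem HasCycles.hasSunlets_layer {L a t : ℕ} : HasCycles L a t → HasSunlets L a →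
    HasSunlets L (a + t) :=
  fun ⟨C⟩ ⟨S⟩ => .of_prod (C.layer S) (by simp)

/-- Every `m ≥ 2` is a sum of twos and threes, and sunlet systems add over products. -/
theorem hasSunlets_mul_of_two_three {L a : ℕ} (h2 : HasSunlets L (2 * a))
    (h3 : HasSunlets L (3 * a)) (m : ℕ) (hm : 2 ≤ m) : HasSunlets L (m * a) := by
  induction m using Nat.strong_induction_on with
  | _ m ih =>
    rcases Nat.lt_or_ge m 4 with h | h
    · interval_cases m
      · exact h2
      · exact h3
    · have := (ih (m - 2) (by omega) (by omega)).add h2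
      rwa [← Nat.add_mul, Nat.sub_add_cancel hm] at this

/-- Two copies attach to each other. For three, the doubled cycle system has `t + t` cycles at each
vertex, which is just the dimension of the third copy, so layering applies. -/
theorem HasCycles.hasSunlets_mul {L t : ℕ} (h : HasCycles L (2 * t) t) (m : ℕ) (hm : 2 ≤ m) :
    HasSunlets L (m * (2 * t)) := by
  have h2 := h.hasSunlets_add_self
  have h3 := (h.add h).hasSunlets_layer h2
  refine hasSunlets_mul_of_two_three ?_ ?_ m hm
  · rwa [Nat.two_mul]
  · rwa [show 3 * (2 * t) = 2 * t + 2 * t + (t + t) by omega]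

/-! ### A binary counter driven by a clock -/

theorem zmod_val_add_one {L : ℕ} [NeZero L] (a : ZMod L) :
    (a + 1).val = if a = -1 then 0 else a.val + 1 := by
  split_ifs with h
  · rw [h, neg_add_cancel, ZMod.val_zero]
  · obtain ⟨n, rfl⟩ : ∃ n, L = n + 1 := ⟨L - 1, by have := NeZero.pos L; omega⟩
    have h1 := ZMod.val_lt a
    have h2 : a.val ≠ n := fun h' => h (ZMod.val_injective _ (by rw [h', ZMod.val_neg_one]))
    rw [ZMod.val_add, ZMod.val_one_eq_one_mod, Nat.add_mod_mod, Nat.mod_eq_of_lt (by omega)]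

/-- A binary counter: if the digit `δ i` flips exactly when the clock `p` shows `c i` and all
smaller digits vanish, then clock and digits together run through a full cycle. -/
theorem exists_counter {Ω : Type} {T : Ω → Ω} {M W : ℕ} [NeZero M] {p : Ω → ZMod M}
    {δ : Fin W → Ω → Bool} {c : Fin W → ZMod M} {K : ℕ} (hK : K ≤ W)
    (hp : ∀ ω, p (T ω) = p ω + 1)
    (hδ : ∀ i : Fin W, i.val < K → ∀ ω,
      δ i (T ω) = xor (δ i ω) (decide (p ω = c i ∧ ∀ l < i, δ l ω = false)))
    (hne : ∀ i : Fin W, i.val < K → ∃ ω, p ω = c i ∧ ∀ l < i, δ l ω = false) (k : ℕ)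
    (hk : k ≤ K) : ∃ ρ : Ω → ZMod (M * 2 ^ k), (∀ ω, ρ (T ω) = ρ ω + 1) ∧
      ∀ ω ω', ρ ω = ρ ω' ↔ p ω = p ω' ∧ ∀ l : Fin W, l.val < k → δ l ω = δ l ω' := by
  induction k with
  | zero =>
    refine ⟨fun ω => (ZMod.ringEquivCongr (by simp)) (p ω), fun ω => ?_, fun ω ω' => ?_⟩
    · simp [hp]
    · simp
  | succ k ih =>
    obtain ⟨L, hL⟩ : ∃ L, L = M * 2 ^ k := ⟨_, rfl⟩
    rw [pow_succ, ← mul_assoc, ← hL]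
    rw [← hL] at ih
    obtain ⟨ρ, hρ, hiff⟩ := ih (by omega)
    have : NeZero L := ⟨hL ▸ (Nat.mul_pos (NeZero.pos M) (by positivity)).ne'⟩
    let i : Fin W := ⟨k, by omega⟩
    obtain ⟨ω₀, h0p, h0δ⟩ := hne i (by simp only [i]; omega)
    -- The flipping condition prescribes the clock and all lower digits, hence exactly one value of
    -- the old rank.
    have hev : ∀ ω, (p ω = c i ∧ ∀ l < i, δ l ω = false) ↔ ρ ω = ρ ω₀ := by
      intro ω
      rw [hiff, h0p]
      refine and_congr_right fun _ => ⟨fun h l hl => ?_, fun h l hl => ?_⟩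
      · rw [h l hl, h0δ l hl]
      · rw [h l hl, h0δ l hl]
    have hL0 : 0 < L := NeZero.pos L
    have hlt : ∀ ω, (ρ ω - (ρ ω₀ + 1)).val < L := fun ω => ZMod.val_lt _
    -- The old rank is shifted so that the new digit flips just when the representative wraps from
    -- `L - 1` to `0`; the digit then acts as the carry of weight `L`.
    refine ⟨fun ω => (((ρ ω - (ρ ω₀ + 1)).val + if δ i ω then L else 0 : ℕ) : ZMod (L * 2)),
      fun ω => ?_, fun ω ω' => ?_⟩
    · have h1 : ρ (T ω) - (ρ ω₀ + 1) = ρ ω - (ρ ω₀ + 1) + 1 := by rw [hρ]; ring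
      have h2 : ρ ω - (ρ ω₀ + 1) = -1 ↔ ρ ω = ρ ω₀ := by
        rw [sub_eq_iff_eq_add, neg_add_cancel_comm_assoc]
      simp only [h1, zmod_val_add_one, h2]
      rw [hδ i (by simp only [i]; omega)]
      simp only [hev]
      by_cases h : ρ ω = ρ ω₀
      · have h3 : (ρ ω - (ρ ω₀ + 1)).val = L - 1 := by
          rw [h2.2 h]
          obtain ⟨n, hn⟩ : ∃ n, L = n + 1 := ⟨L - 1, by omega⟩
          subst hn
          rw [ZMod.val_neg_one]; rfl
        rw [h3]
        have h4 : (L - 1 : ℕ) + 1 = L := by omega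
        cases hd : δ i ω
        · simp only [h, if_true, decide_true, Bool.false_eq_true, if_false,
            Bool.xor_true, Bool.not_false]
          rw [← Nat.cast_add_one, add_zero, h4, zero_add]
        · simp only [h, if_true, decide_true, Bool.xor_true, Bool.not_true, Bool.false_eq_true,
            if_false]
          rw [← Nat.cast_add_one, show L - 1 + L + 1 = L * 2 by omega, ZMod.natCast_self,
            add_zero, Nat.cast_zero]
      · simp only [h, if_false, decide_false, Bool.xor_false]
        rw [← Nat.cast_add_one]
        congr 1
        ring
    · have hlt' : ∀ ω, (ρ ω - (ρ ω₀ + 1)).val + (if δ i ω then L else 0) < L * 2 := by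
        intro ω
        have := hlt ω
        split_ifs <;> omega
      rw [ZMod.natCast_eq_natCast_iff', Nat.mod_eq_of_lt (hlt' ω), Nat.mod_eq_of_lt (hlt' ω')]
      have hsplit : ((ρ ω - (ρ ω₀ + 1)).val + (if δ i ω then L else 0) =
          (ρ ω' - (ρ ω₀ + 1)).val + (if δ i ω' then L else 0)) ↔
          (ρ ω - (ρ ω₀ + 1)).val = (ρ ω' - (ρ ω₀ + 1)).val ∧ δ i ω = δ i ω' := by
        have h1 := hlt ω
        have h2 := hlt ω'
        cases δ i ω <;> cases δ i ω' <;> simp <;> omega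
      rw [hsplit, (ZMod.val_injective L).eq_iff, sub_left_inj, hiff, and_assoc]
      refine and_congr_right fun _ => ⟨fun h l hl => ?_, fun h => ⟨fun l hl => h l (by omega), ?_⟩⟩
      · rcases Nat.lt_succ_iff_lt_or_eq.1 hl with h' | h'
        · exact h.1 l h'
        · obtain rfl : l = i := Fin.ext h'
          exact h.2
      · exact h i (by simp only [i]; omega)

theorem iterate_add_one {Ω : Type} {T : Ω → Ω} {L : ℕ} {ρ : Ω → ZMod L}
    (h : ∀ ω, ρ (T ω) = ρ ω + 1) (m : ℕ) (ω : Ω) : ρ (T^[m] ω) = ρ ω + m := by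
  induction m with
  | zero => simp
  | succ m ih => rw [Function.iterate_succ_apply', h, ih]; push_cast; ring

theorem iterate_invariant {Ω X : Type} {T : Ω → Ω} {f : Ω → X} (h : ∀ ω, f (T ω) = f ω) (m : ℕ)
    (ω : Ω) : f (T^[m] ω) = f ω := by
  induction m with
  | zero => rfl
  | succ m ih => rw [Function.iterate_succ_apply', h, ih]

theorem iterate_ne_of_counter {Ω : Type} {T : Ω → Ω} {L : ℕ} {ρ : Ω → ZMod L}
    (h : ∀ ω, ρ (T ω) = ρ ω + 1) {m : ℕ} (hm : 0 < m) (hm' : m < L) (ω : Ω) : T^[m] ω ≠ ω := by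
  intro he
  have := iterate_add_one h m ω
  rw [he, left_eq_add, ZMod.natCast_eq_zero_iff] at this
  exact absurd (Nat.le_of_dvd hm this) (by omega)

/-! ### The rotor walk and its invariants -/

section Rotor

variable {N : ℕ}

/-- Words made of `N + 1` two-letter blocks. -/
abbrev BlockWord (N : ℕ) := Fin (N + 1) × Bool → Bool

/-- The parity of a block. -/
def blockParity (y : BlockWord N) (i : Fin (N + 1)) : Bool := xor (y (i, false)) (y (i, true))

theorem blockParity_cubeStep (y : BlockWord N) (i j : Fin (N + 1)) (ε : Bool) :
    blockParity (cubeStep _ (j, ε) y) i = xor (blockParity y i) (decide (i = j)) := by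
  unfold blockParity
  by_cases h : i = j
  · subst h
    cases ε <;> simp [cubeStep_apply]
  · simp [cubeStep_apply, h]

/-- The orientation of the square in block `i` at the word `y`; it does not depend on block `i`.
The last block carries a flag, and the first `K` blocks carry the digits of a counter. -/
def orientation (K : ℕ) (y : BlockWord N) (i : Fin (N + 1)) : Bool :=
  if i = Fin.last N then blockParity y 0
  else xor (blockParity y (Fin.last N)) (decide (i.val < K ∧ blockParity y (Fin.last N) = false ∧
    ∀ l < i, y (l, true) = false))

theorem orientation_cubeStep (hN : 1 ≤ N) (K : ℕ) (y : BlockWord N) (i : Fin (N + 1)) (ε : Bool) :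
    orientation K (cubeStep _ (i, ε) y) i = orientation K y i := by
  unfold orientation
  split_ifs with h
  · have h0 : (0 : Fin (N + 1)) ≠ i := by
      rw [h]
      exact fun h' => by
        have := congrArg Fin.val h'
        simp at this
        omega
    simp [blockParity_cubeStep, h0]
  · have h1 : ∀ l < i, cubeStep _ (i, ε) y (l, true) = y (l, true) := by
      intro l hl
      simp [cubeStep_apply, hl.ne]
    have h2 : blockParity (cubeStep _ (i, ε) y) (Fin.last N) = blockParity y (Fin.last N) := by
      simp [blockParity_cubeStep, Ne.symm h]
    rw [h2]
    congr 1
    simp only [decide_eq_decide]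
    refine and_congr_right fun _ => and_congr_right fun _ => ?_
    exact forall₂_congr fun l hl => by rw [h1 l hl]

/-- The letter of block `i` that is flipped at the word `y`. -/
def turn (K : ℕ) (y : BlockWord N) (i : Fin (N + 1)) : Bool :=
  xor (blockParity y i) (orientation K y i)

theorem turn_cubeStep (hN : 1 ≤ N) (K : ℕ) (y : BlockWord N) (i : Fin (N + 1)) (ε : Bool) :
    turn K (cubeStep _ (i, ε) y) i = !turn K y i := by
  unfold turn
  rw [orientation_cubeStep hN, blockParity_cubeStep]
  simp

/-- Flipping a letter of block `i` reverses the turn in that block, so of the two ends of an edge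
exactly one leaves along it. -/
theorem rotor_cover (hN : 1 ≤ N) (K : ℕ) (y : BlockWord N) (l : Fin (N + 1) × Bool) :
    ∃! ω : BlockWord N × Fin (N + 1), (ω.2, turn K ω.1 ω.2) = l ∧
      (ω.1 = y ∨ ω.1 = cubeStep _ l y) := by
  obtain ⟨i, ε⟩ := l
  by_cases h : turn K y i = ε
  · refine ⟨(y, i), ⟨by rw [h], Or.inl rfl⟩, ?_⟩
    rintro ⟨y', i'⟩ ⟨h1, h2⟩
    rw [Prod.mk.injEq] at h1
    obtain ⟨rfl, h1⟩ := h1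
    rcases h2 with rfl | h2
    · rfl
    · rw [h2] at h1
      simp only [turn_cubeStep hN, h] at h1
      cases ε <;> cases h1
  · refine ⟨(cubeStep _ (i, ε) y, i), ⟨?_, Or.inr rfl⟩, ?_⟩
    · simp only [turn_cubeStep hN]
      congr 1
      revert h
      cases turn K y i <;> cases ε <;> simp
    · rintro ⟨y', i'⟩ ⟨h1, h2⟩
      rw [Prod.mk.injEq] at h1
      obtain ⟨rfl, h1⟩ := h1
      rcases h2 with rfl | h2
      · exact absurd h1 h
      · rw [show y' = _ from h2]

/-- The rotor walk goes through the blocks cyclically and flips one letter in each. -/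
def rotor (K : ℕ) (ω : BlockWord N × Fin (N + 1)) : BlockWord N × Fin (N + 1) :=
  (cubeStep _ (ω.2, turn K ω.1 ω.2) ω.1, ω.2 + 1)

/-- The round the walk is in. -/
def flag (ω : BlockWord N × Fin (N + 1)) : Bool := blockParity ω.1 (Fin.last N)

/-- Whether block `i` is between its first and its second visit in a double round. -/
def midway (ω : BlockWord N × Fin (N + 1)) (i : Fin (N + 1)) : Bool :=
  xor (flag ω) (decide (i < ω.2))

/-- The parity of block `i` at the end of a double round. -/
def baseParity (ω : BlockWord N × Fin (N + 1)) (i : Fin (N + 1)) : Bool :=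
  xor (blockParity ω.1 i) (midway ω i)

/-- The first letter of block `i` at the end of a double round. -/
def digit (i : Fin (N + 1)) (ω : BlockWord N × Fin (N + 1)) : Bool := ω.1 (i, midway ω i)

/-- The first letter of the last block at the end of a double round. -/
def lastDigit (ω : BlockWord N × Fin (N + 1)) : Bool :=
  xor (ω.1 (Fin.last N, false)) (flag ω && baseParity ω 0)

/-- The number of steps since the start of the double round. -/
def clock (ω : BlockWord N × Fin (N + 1)) : ZMod (2 * (N + 1)) :=
  ((ω.2.val + if flag ω then N + 1 else 0 : ℕ) : ZMod (2 * (N + 1)))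

theorem flag_rotor (K : ℕ) (ω : BlockWord N × Fin (N + 1)) :
    flag (rotor K ω) = xor (flag ω) (decide (Fin.last N = ω.2)) :=
  blockParity_cubeStep _ _ _ _

/-- When the walk wraps around, the flag changes and `i < ω.2` is lost; the two changes cancel, so
only a visit to block `i` matters. -/
theorem midway_rotor (K : ℕ) (ω : BlockWord N × Fin (N + 1)) (i : Fin (N + 1))
    (hi : i ≠ Fin.last N) : midway (rotor K ω) i = xor (midway ω i) (decide (i = ω.2)) := by
  unfold midway
  rw [flag_rotor]
  obtain ⟨y, j⟩ := ω
  change xor (xor _ _) (decide (i < j + 1)) = _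
  rcases eq_or_ne j (Fin.last N) with rfl | hj
  · have h1 : i < Fin.last N := Fin.lt_last_iff_ne_last.2 hi
    simp [hi, h1]
  · have h1 : decide (i < j + 1) = xor (decide (i < j)) (decide (i = j)) := by
      have h2 : (i < j + 1) ↔ (i < j ∨ i = j) := by
        rw [Fin.lt_def, Fin.lt_def, Fin.ext_iff,
          Fin.val_add_one_of_lt (Fin.lt_last_iff_ne_last.2 hj)]
        omega
      by_cases h4 : i = j
      · rw [decide_eq_true (h2.2 (Or.inr h4))]
        simp [h4]
      · have h5 : (i < j + 1) ↔ i < j := by simp [h2, h4]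
        simp only [h5, h4, decide_false, Bool.xor_false]
    rw [h1]
    simp [Ne.symm hj]

/-- Both terms of the sum change exactly when block `i` is visited. -/
theorem baseParity_rotor (K : ℕ) (ω : BlockWord N × Fin (N + 1)) (i : Fin (N + 1))
    (hi : i ≠ Fin.last N) : baseParity (rotor K ω) i = baseParity ω i := by
  unfold baseParity
  rw [midway_rotor K ω i hi]
  change xor (blockParity (cubeStep _ _ _) i) _ = _
  rw [blockParity_cubeStep]
  cases blockParity ω.1 i <;> cases midway ω i <;> cases decide (i = ω.2) <;> rfl

/-- Opposite orientations at the two visits flip the same letter twice. The counter condition,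
tested only at the first visit, makes the orientations agree, so both letters get flipped. The
smaller blocks are then midway, where their second letter shows their updated digit. -/
theorem digit_rotor (K : ℕ) (ω : BlockWord N × Fin (N + 1)) (i : Fin (N + 1))
    (hi : i ≠ Fin.last N) : digit i (rotor K ω) = xor (digit i ω)
      (decide (i = ω.2 ∧ i.val < K ∧ flag ω = false ∧ ∀ l < i, digit l ω = false)) := by
  unfold digit
  rw [midway_rotor K ω i hi]
  obtain ⟨y, j⟩ := ω
  change cubeStep _ _ _ _ = _
  by_cases hij : i = j
  · subst hij
    have hmid : midway (y, i) i = flag (y, i) := by simp [midway]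
    have hlt : ∀ l < i, midway (y, i) l = !flag (y, i) := fun l hl => by simp [midway, hl]
    rw [hmid]
    have ho : orientation K y i = xor (flag (y, i)) (decide (i.val < K ∧ flag (y, i) = false ∧
        ∀ l < i, y (l, midway (y, i) l) = false)) := by
      unfold orientation
      rw [if_neg hi]
      congr 1
      simp only [decide_eq_decide]
      refine and_congr_right fun _ => and_congr_right fun hf => forall₂_congr fun l hl => ?_
      rw [hlt l hl, show flag (y, i) = false from hf]
      rfl
    simp only [cubeStep_apply, turn, ho, Prod.mk.injEq, true_and, decide_true, Bool.xor_true]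
    generalize hE : decide (i.val < K ∧ flag (y, i) = false ∧
      ∀ l < i, y (l, midway (y, i) l) = false) = E
    unfold blockParity
    cases hf : flag (y, i)
    · simp only [Bool.not_false]
      cases y (i, false) <;> cases y (i, true) <;> cases E <;> simp
    · obtain rfl : E = false := by rw [← hE, hf]; simp
      simp only [Bool.not_true]
      cases y (i, false) <;> cases y (i, true) <;> simp
  · simp [cubeStep_apply, hij]

theorem clock_rotor (K : ℕ) (ω : BlockWord N × Fin (N + 1)) :
    clock (rotor K ω) = clock ω + 1 := by
  unfold clock
  rw [flag_rotor]
  obtain ⟨y, j⟩ := ω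
  change (((j + 1 : Fin (N + 1)).val + _ : ℕ) : ZMod (2 * (N + 1))) = _
  rcases eq_or_ne j (Fin.last N) with rfl | hj
  · cases hf : flag (y, Fin.last N)
    · simp
    · have := ZMod.natCast_self (2 * (N + 1))
      push_cast at this
      simp
      linear_combination -this
  · rw [Fin.val_add_one_of_lt (Fin.lt_last_iff_ne_last.2 hj)]
    simp only [Ne.symm hj, decide_false, Bool.xor_false]
    push_cast
    ring

/-- Block `0` has been flipped once before the first visit to the last block and twice before the
second, so the last block sees opposite orientations and returns to its value. The correction term
records which letter is temporarily flipped. -/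
theorem lastDigit_rotor (hN : 1 ≤ N) (K : ℕ) (ω : BlockWord N × Fin (N + 1)) :
    lastDigit (rotor K ω) = lastDigit ω := by
  have h0 : (0 : Fin (N + 1)) ≠ Fin.last N := fun h' => by
    have := congrArg Fin.val h'
    simp at this
    omega
  unfold lastDigit
  rw [baseParity_rotor K ω 0 h0, flag_rotor]
  obtain ⟨y, j⟩ := ω
  change xor (cubeStep _ _ _ _) _ = _
  by_cases hj : Fin.last N = j
  · subst hj
    have hb : baseParity (y, Fin.last N) 0 = !xor (blockParity y 0) (flag (y, Fin.last N)) := by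
      have : (0 : Fin (N + 1)) < Fin.last N := Fin.lt_last_iff_ne_last.2 h0
      simp [baseParity, midway, this]
    rw [hb]
    simp only [cubeStep_apply, turn, orientation, if_true, Prod.mk.injEq, true_and,
      show blockParity y (Fin.last N) = flag (y, Fin.last N) from rfl, decide_true, Bool.xor_true]
    cases y (Fin.last N, false) <;> cases blockParity y 0 <;> cases flag (y, Fin.last N) <;> rfl
  · simp [cubeStep_apply, hj]

/-- In a given orbit the position of the walk determines the next block. -/
theorem rotor_state_ext {ω ω' : BlockWord N × Fin (N + 1)} (h : ω.1 = ω'.1)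
    (hb : ∀ i ≠ Fin.last N, baseParity ω i = baseParity ω' i) : ω = ω' := by
  obtain ⟨y, j⟩ := ω
  obtain ⟨y', j'⟩ := ω'
  obtain rfl : y = y' := h
  have key : ∀ i ≠ Fin.last N, i < j ↔ i < j' := by
    intro i hi
    have := hb i hi
    simpa [baseParity, midway, flag] using this
  rw [Prod.mk.injEq]
  refine ⟨rfl, ?_⟩
  by_contra hne
  rcases lt_or_gt_of_ne hne with hlt | hlt
  · exact lt_irrefl j ((key j (ne_of_lt (hlt.trans_le (Fin.le_last _)))).2 hlt)
  · exact lt_irrefl j' ((key j' (ne_of_lt (hlt.trans_le (Fin.le_last _)))).1 hlt)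

theorem clock_eq_iff {ω ω' : BlockWord N × Fin (N + 1)} :
    clock ω = clock ω' ↔ ω.2 = ω'.2 ∧ flag ω = flag ω' := by
  have hlt : ∀ ω : BlockWord N × Fin (N + 1),
      ω.2.val + (if flag ω then N + 1 else 0) < 2 * (N + 1) := by
    intro ω
    have := ω.2.isLt
    split_ifs <;> omega
  unfold clock
  rw [ZMod.natCast_eq_natCast_iff', Nat.mod_eq_of_lt (hlt _), Nat.mod_eq_of_lt (hlt _), Fin.ext_iff]
  have h1 := ω.2.isLt
  have h2 := ω'.2.isLt
  cases flag ω <;> cases flag ω' <;> simp <;> omega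

/-- These data are a coordinate system in which the rotor only changes clock and digits. Digit and
base parity recover the two letters of a block; last digit and flag recover those of the last block.
-/
theorem rotor_state_ext' {ω ω' : BlockWord N × Fin (N + 1)} (hc : clock ω = clock ω')
    (hd : ∀ i ≠ Fin.last N, digit i ω = digit i ω')
    (hb : ∀ i ≠ Fin.last N, baseParity ω i = baseParity ω' i)
    (hl : lastDigit ω = lastDigit ω') (hN : 1 ≤ N) : ω = ω' := by
  have h0 : (0 : Fin (N + 1)) ≠ Fin.last N := fun h' => by
    have := congrArg Fin.val h'
    simp at this
    omega
  obtain ⟨h1, h2⟩ := clock_eq_iff.1 hc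
  refine rotor_state_ext (funext fun ⟨i, ε⟩ => ?_) hb
  have hm : midway ω i = midway ω' i := by unfold midway; rw [h1, h2]
  rcases eq_or_ne i (Fin.last N) with rfl | hi
  · unfold lastDigit at hl
    rw [hb 0 h0, h2] at hl
    unfold flag blockParity at h2
    have h3 : ω.1 (Fin.last N, false) = ω'.1 (Fin.last N, false) := by
      simpa using hl
    rw [h3] at h2
    cases ε
    · exact h3
    · simpa using h2
  · have h3 := hd i hi
    have h4 := hb i hi
    unfold digit at h3
    unfold baseParity blockParity at h4
    rw [hm] at h3 h4
    cases hε : midway ω' i <;> rw [hε] at h3 h4 <;> rw [h3] at h4 <;> cases ε <;> simp_all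

end Rotor

/-! ### Cycles and sunlets from the rotor -/

section RotorSystems

variable {N K : ℕ}

theorem exists_rotor_counter (hK : K ≤ N) :
    ∃ ρ : BlockWord N × Fin (N + 1) → ZMod (2 * (N + 1) * 2 ^ K),
      (∀ ω, ρ (rotor K ω) = ρ ω + 1) ∧ ∀ ω ω', ρ ω = ρ ω' ↔ clock ω = clock ω' ∧
        ∀ l : Fin (N + 1), l.val < K → digit l ω = digit l ω' := by
  have hflag : ∀ i : Fin (N + 1), flag ((fun _ => false, i) : BlockWord N × Fin (N + 1)) = false :=
    fun i => rfl
  -- The zero word has flag `false`, so this is the time of the first visit to block `i`; it also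
  -- witnesses that the flipping condition can occur.
  refine exists_counter (c := fun i => clock ((fun _ => false, i) : BlockWord N × Fin (N + 1)))
    (hK.trans (Nat.le_succ N)) (clock_rotor K) (fun i hi ω => ?_)
    (fun i _ => ⟨(fun _ => false, i), rfl, fun _ _ => rfl⟩) K le_rfl
  rw [digit_rotor K ω i (fun h => by rw [h, Fin.val_last] at hi; omega)]
  congr 1
  rw [decide_eq_decide, clock_eq_iff, hflag]
  constructor
  · rintro ⟨h1, -, h2, h3⟩
    exact ⟨⟨h1.symm, h2⟩, h3⟩
  · rintro ⟨⟨h1, h2⟩, h3⟩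
    exact ⟨h1.symm, hi, h2, h3⟩

/-- The counter returns the clock and the first `K` digits; the remaining coordinates of the state
are invariant. -/
theorem rotor_iterate_period (hN : 1 ≤ N) (hK : K ≤ N) (ω : BlockWord N × Fin (N + 1)) :
    (rotor K)^[2 * (N + 1) * 2 ^ K] ω = ω := by
  obtain ⟨ρ, hρ, hiff⟩ := exists_rotor_counter (N := N) hK
  have h := iterate_add_one hρ (2 * (N + 1) * 2 ^ K) ω
  rw [ZMod.natCast_self, add_zero] at h
  obtain ⟨hc, hd⟩ := (hiff _ _).1 h
  refine rotor_state_ext' hc (fun i hi => ?_)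
    (fun i hi => iterate_invariant (f := fun ω => baseParity ω i)
      (fun ω => baseParity_rotor K ω i hi) _ ω)
    (iterate_invariant (lastDigit_rotor hN K) _ ω) hN
  rcases Nat.lt_or_ge i.val K with h' | h'
  · exact hd i h'
  · exact iterate_invariant (f := digit i)
      (fun ω => by rw [digit_rotor K ω i hi]; simp [Nat.not_lt.2 h']) _ ω

theorem baseParity_rotor_iterate (m : ℕ) (ω : BlockWord N × Fin (N + 1)) (i : Fin (N + 1))
    (hi : i ≠ Fin.last N) : baseParity ((rotor K)^[m] ω) i = baseParity ω i :=
  iterate_invariant (f := fun ω => baseParity ω i) (fun ω => baseParity_rotor K ω i hi) m ω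

theorem rotor_iterate_fst_ne (hK : K ≤ N) (ω : BlockWord N × Fin (N + 1)) {m : ℕ} (hm : 0 < m)
    (hm' : m < 2 * (N + 1) * 2 ^ K) : ((rotor K)^[m] ω).1 ≠ ω.1 := by
  obtain ⟨ρ, hρ, -⟩ := exists_rotor_counter (N := N) hK
  exact fun h => iterate_ne_of_counter hρ hm hm' ω
    (rotor_state_ext h fun i hi => baseParity_rotor_iterate m ω i hi)

/-- The closed walks of the rotor. -/
def rotorCycles (hN : 1 ≤ N) (hK : K ≤ N) :
    CycleSystem (cubeStep (Fin (N + 1) × Bool)) (Fin (N + 1)) (2 * (N + 1) * 2 ^ K) where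
  dir ω := (ω.2, turn K ω.1 ω.2)
  next := rotor K
  next_fst _ := rfl
  iterate_next := rotor_iterate_period hN hK
  simple ω _ hm hm' := rotor_iterate_fst_ne hK ω hm hm'
  cover := rotor_cover hN K

/-- With an even number of blocks, the parity of the block index survives the wrap-around, so the
states split into two alternating classes. -/
theorem natCast_fin_add_one (hodd : Odd N) (j : Fin (N + 1)) :
    (((j + 1 : Fin (N + 1)).val : ℕ) : ZMod 2) = j.val + 1 := by
  rcases eq_or_ne j (Fin.last N) with rfl | hj
  · obtain ⟨k, rfl⟩ := hodd
    have h2 : (2 : ZMod 2) = 0 := rfl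
    simp
    linear_combination (-(k : ZMod 2) - 1) * h2
  · rw [Fin.val_add_one_of_lt (Fin.lt_last_iff_ne_last.2 hj)]
    push_cast
    rfl

/-- The states of the rotor that stay on the cycles when every second edge is cut off. -/
abbrev EvenRotorState (N : ℕ) := {ω : BlockWord N × Fin (N + 1) // parity ω.1 = (ω.2.val : ZMod 2)}

/-- The end vertex of the pendant edge at a state. -/
def rotorEnd (K : ℕ) (ω : BlockWord N × Fin (N + 1)) : BlockWord N :=
  cubeStep _ (ω.2 + 1, turn K ω.1 (ω.2 + 1)) ω.1

/-- Base parities are constant on an orbit, so reading them off the pendant end constrains its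
position. The nested equivalence is the sum modulo 2 of its three propositions. -/
theorem baseParity_eq_rotorEnd (K : ℕ) (ω : BlockWord N × Fin (N + 1)) (i : Fin (N + 1)) :
    baseParity ω i = xor (xor (blockParity (rotorEnd K ω) i)
      (blockParity (rotorEnd K ω) (Fin.last N)))
      (decide (i < ω.2 ↔ (i = ω.2 + 1 ↔ Fin.last N = ω.2 + 1))) := by
  unfold rotorEnd
  rw [blockParity_cubeStep, blockParity_cubeStep]
  have h : ∀ a b c : Prop, ∀ [Decidable a] [Decidable b] [Decidable c],
      decide (a ↔ (b ↔ c)) = xor (decide a) (xor (decide b) (decide c)) := by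
    intro a b c _ _ _
    by_cases a <;> by_cases b <;> by_cases c <;> simp [*]
  rw [h]
  unfold baseParity midway flag
  cases blockParity ω.1 i <;> cases blockParity ω.1 (Fin.last N) <;>
    cases decide (i = ω.2 + 1) <;> cases decide (Fin.last N = ω.2 + 1) <;>
    cases decide (i < ω.2) <;> rfl

theorem val_add_one_cases (j : Fin (N + 1)) :
    (j.val = N ∧ (j + 1 : Fin (N + 1)).val = 0) ∨
      (j.val < N ∧ (j + 1 : Fin (N + 1)).val = j.val + 1) := by
  rcases eq_or_ne j (Fin.last N) with rfl | hj
  · left; simp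
  · right
    have := Fin.lt_last_iff_ne_last.2 hj
    exact ⟨by simpa [Fin.lt_def] using this, Fin.val_add_one_of_lt this⟩

/-- Relative to the base parities, a cycle vertex displays an initial segment of the blocks below
`N`. With `j = ω.2`, a pendant end displays `{0, …, j - 1, j + 1}` for `j + 1 < N`, `{N - 1}` for `j
= N - 1`, and `{1, …, N - 1}` for `j = N`; none of these is an initial segment. -/
theorem rotorEnd_ne (hN : 3 ≤ N) {ω ω' : BlockWord N × Fin (N + 1)}
    (hb : ∀ i ≠ Fin.last N, baseParity ω' i = baseParity ω i) : ω'.1 ≠ rotorEnd K ω := by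
  intro h
  have key : ∀ i : ℕ, i < N → (i < ω'.2.val ↔ (i < ω.2.val ↔
      (i = (ω.2 + 1).val ↔ N = (ω.2 + 1).val))) := by
    intro i hi
    have h1 := hb ⟨i, by omega⟩ (fun h => by have := congrArg Fin.val h; simp at this; omega)
    rw [baseParity_eq_rotorEnd K ω] at h1
    unfold baseParity midway flag at h1
    rw [h, ← Bool.xor_assoc, Bool.xor_right_inj, decide_eq_decide] at h1
    simpa [Fin.lt_def, Fin.ext_iff] using h1
  have h0 := key 0 (by omega)
  have h1 := key 1 (by omega)
  have h2 := key (N - 1) (by omega)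
  rcases val_add_one_cases ω.2 with ⟨h3, h4⟩ | ⟨h3, h4⟩
  · omega
  · have h5 := key ω.2.val h3
    rcases Nat.lt_or_ge (ω.2.val + 1) N with h6 | h6
    · have h7 := key (ω.2.val + 1) h6
      omega
    · omega

/-- The sets displayed by pendant ends differ for different blocks. For `N = 2` they would not: `j =
0` and `j = 2` would both give `{1}`. -/
theorem snd_eq_of_rotorEnd_eq (hN : 3 ≤ N) {ω ω' : BlockWord N × Fin (N + 1)}
    (hb : ∀ i ≠ Fin.last N, baseParity ω' i = baseParity ω i)
    (h : rotorEnd K ω' = rotorEnd K ω) : ω'.2 = ω.2 := by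
  have key : ∀ i : ℕ, i < N → ((i < ω'.2.val ↔
      (i = (ω'.2 + 1).val ↔ N = (ω'.2 + 1).val)) ↔ (i < ω.2.val ↔
      (i = (ω.2 + 1).val ↔ N = (ω.2 + 1).val))) := by
    intro i hi
    have h1 := hb ⟨i, by omega⟩ (fun h => by have := congrArg Fin.val h; simp at this; omega)
    rw [baseParity_eq_rotorEnd K ω, baseParity_eq_rotorEnd K ω', h, Bool.xor_right_inj,
      decide_eq_decide] at h1
    simpa [Fin.lt_def, Fin.ext_iff] using h1
  have h0 := key 0 (by omega)
  have h1 := key 1 (by omega)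
  have h2 := key 2 (by omega)
  have h3 := key (N - 1) (by omega)
  have h4 := key (N - 2) (by omega)
  apply Fin.ext
  by_contra hne
  rcases val_add_one_cases ω.2 with ⟨h5, h6⟩ | ⟨h5, h6⟩ <;>
    rcases val_add_one_cases ω'.2 with ⟨h7, h8⟩ | ⟨h7, h8⟩
  · omega
  · have := key ω'.2.val h7
    omega
  · have := key ω.2.val h5
    omega
  · have a1 := key ω'.2.val h7
    have a2 := key ω.2.val h5
    omega

/-- The turn at the end vertex is opposite to the one used, so it reveals which letter to flip back.
-/
theorem rotorEnd_injective (hN : 1 ≤ N) {ω ω' : BlockWord N × Fin (N + 1)} (h2 : ω'.2 = ω.2)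
    (h : rotorEnd K ω' = rotorEnd K ω) : ω' = ω := by
  obtain ⟨y, j⟩ := ω
  obtain ⟨y', j'⟩ := ω'
  obtain rfl : j' = j := h2
  have ht := congrArg (fun z => turn K z (j' + 1)) h
  simp only [rotorEnd, turn_cubeStep hN, Bool.not_eq_eq_eq_not, Bool.not_not] at ht
  unfold rotorEnd at h
  simp only at h
  rw [ht] at h
  have := congrArg (cubeStep _ (j' + 1, turn K y (j' + 1))) h
  rw [cubeStep_cubeStep, cubeStep_cubeStep] at this
  rw [this]

/-- The rotor restricted to every second state; the other states give the pendant edges. -/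
def rotorSunlets (hN : 3 ≤ N) (hodd : Odd N) (hK : K ≤ N) :
    SunletSystem (cubeStep (Fin (N + 1) × Bool)) (2 * (N + 1) * 2 ^ K) :=
  have hstep : ∀ ω : EvenRotorState N,
      parity (rotor K ω.1).1 = ((rotor K ω.1).2.val : ZMod 2) := fun ω => by
    change parity (cubeStep _ _ _) = (((ω.1.2 + 1 : Fin (N + 1)).val : ℕ) : ZMod 2)
    rw [parity_cubeStep, ω.2, natCast_fin_add_one hodd]
  let next : EvenRotorState N → EvenRotorState N := fun ω => ⟨rotor K ω.1, hstep ω⟩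
  have hnext : ∀ m ω, (next^[m] ω).1 = (rotor K)^[m] ω.1 := fun m ω =>
    (iterate_semiconj (φ := Subtype.val) (f := next) (g := rotor K) (fun _ => rfl) m ω).symm
  { State := EvenRotorState N
    pos := fun ω => ω.1.1
    next := next
    dir := fun ω => (ω.1.2, turn K ω.1.1 ω.1.2)
    out := fun ω => (ω.1.2 + 1, turn K ω.1.1 (ω.1.2 + 1))
    pos_next := fun _ => rfl
    iterate_next := fun ω => Subtype.ext (by rw [hnext, rotor_iterate_period (by omega) hK])
    simple := fun ω m hm hm' => by
      rw [hnext]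
      exact rotor_iterate_fst_ne hK ω.1 hm hm'
    out_not_mem := fun ω m => by
      rw [hnext]
      exact rotorEnd_ne hN fun i hi => baseParity_rotor_iterate m ω.1 i hi
    out_simple := fun ω m hm hm' h => by
      rw [hnext] at h
      have h2 := snd_eq_of_rotorEnd_eq hN (fun i hi => baseParity_rotor_iterate m ω.1 i hi) h
      exact rotor_iterate_fst_ne hK ω.1 hm hm'
        (congrArg Prod.fst (rotorEnd_injective (by omega) h2 h))
    cover := fun v i => by
      -- Kept states give cycle edges; moving the block index on by one gives all skipped states,
      -- whose edges are the pendants. Unique coverage is thus inherited from the full rotor.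
      let φ : EvenRotorState N ⊕ EvenRotorState N → BlockWord N × Fin (N + 1) :=
        Sum.elim Subtype.val fun ω => (ω.1.1, ω.1.2 + 1)
      have hφ : Function.Bijective φ := by
        constructor
        · have hne : ∀ ω ω' : EvenRotorState N, ω.1 ≠ (ω'.1.1, ω'.1.2 + 1) := by
            intro ω ω' h
            have h1 := ω.2
            rw [h, natCast_fin_add_one hodd, ω'.2] at h1
            exact absurd h1 (by simp)
          rintro (ω | ω) (ω' | ω') h
          · exact congrArg Sum.inl (Subtype.ext h)
          · exact absurd h (hne ω ω')
          · exact absurd h.symm (hne ω' ω)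
          · have h : (ω.1.1, ω.1.2 + 1) = (ω'.1.1, ω'.1.2 + 1) := h
            rw [Prod.mk.injEq] at h
            exact congrArg Sum.inr (Subtype.ext (Prod.ext h.1 (add_right_cancel h.2)))
        · rintro ⟨y, j⟩
          by_cases h : parity y = (j.val : ZMod 2)
          · exact ⟨Sum.inl ⟨(y, j), h⟩, rfl⟩
          · refine ⟨Sum.inr ⟨(y, j - 1), ?_⟩, Prod.ext rfl (sub_add_cancel j 1)⟩
            have h1 := natCast_fin_add_one hodd (j - 1)
            rw [sub_add_cancel] at h1
            rw [h1] at h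
            change parity y = (((j - 1 : Fin (N + 1)).val : ℕ) : ZMod 2)
            rcases zmod_two_cases (parity y) with h2 | h2 <;>
              rcases zmod_two_cases (((j - 1 : Fin (N + 1)).val : ℕ) : ZMod 2) with h3 | h3 <;>
              rw [h2, h3] at h ⊢ <;> exact absurd rfl h
      refine existsUnique_map (Equiv.ofBijective φ hφ).symm (fun ω => ?_)
        (rotor_cover (by omega) K v i)
      obtain ⟨q, rfl⟩ := (Equiv.ofBijective φ hφ).surjective ω
      rw [Equiv.symm_apply_apply]
      rcases q with ω | ω <;> rfl }

end RotorSystems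

theorem hasCycles_rotor {w : ℕ} (hw : 2 ≤ w) {K : ℕ} (hK : K < w) :
    HasCycles (2 * w * 2 ^ K) (2 * w) w := by
  obtain ⟨N, rfl⟩ : ∃ N, w = N + 1 := ⟨w - 1, by omega⟩
  exact .of_system (rotorCycles (by omega) (by omega : K ≤ N)) (by simp [mul_comm]) (by simp)

theorem hasSunlets_rotor {w : ℕ} (hw : 4 ≤ w) (heven : Even w) {K : ℕ} (hK : K < w) :
    HasSunlets (2 * w * 2 ^ K) (2 * w) := by
  obtain ⟨N, rfl⟩ : ∃ N, w = N + 1 := ⟨w - 1, by omega⟩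
  have hodd : Odd N := by
    rw [Nat.even_add_one, Nat.not_even_iff_odd] at heven
    exact heven
  exact .of_system (rotorSunlets (by omega) hodd (by omega : K ≤ N)) (by simp [mul_comm])

/-- For `k = 0` the rotor on `n / 2` blocks has the right length. For `k > 0` the rotor on `n`
blocks with `k - 1` digits gives sunlets in dimension `2 * n`, and its `n` cycles per vertex allow
layering up to `3 * n`. -/
theorem hasSunlets_mul_of_even {m n k : ℕ} (hm : 2 ≤ m) (hn : 4 ≤ n) (heven : Even n)
    (hk : k ≤ n) : HasSunlets (n * 2 ^ k) (m * n) := by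
  rcases Nat.eq_zero_or_pos k with rfl | hk0
  · obtain ⟨w, rfl⟩ := heven
    have := (hasCycles_rotor (w := w) (K := 0) (by omega) (by omega)).hasSunlets_mul m hm
    rwa [Nat.two_mul] at this
  · have hL : 2 * n * 2 ^ (k - 1) = n * 2 ^ k := by
      obtain ⟨K, rfl⟩ : ∃ K, k = K + 1 := ⟨k - 1, by omega⟩
      rw [Nat.add_sub_cancel, pow_succ]
      ring
    have h1 := hasCycles_rotor (w := n) (K := k - 1) (by omega) (by omega)
    have h2 := hasSunlets_rotor hn heven (K := k - 1) (by omega)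
    rw [hL] at h1 h2
    refine hasSunlets_mul_of_two_three h2 ?_ m hm
    rw [show 3 * n = 2 * n + n by ring]
    exact h1.hasSunlets_layer h2

/-! ### Twisted walks on a product of two cycles -/

theorem iterate_eq_of_dvd {X : Type} {f : X → X} {Q A : ℕ} (hf : ∀ x, f^[Q] x = x) (h : Q ∣ A)
    (x : X) : f^[A] x = x := by
  rw [← iterate_mod_period (hf x), Nat.mod_eq_zero_of_dvd h, Function.iterate_zero, id]

theorem injective_of_iterate {X : Type} {f : X → X} {Q : ℕ} [NeZero Q] (hf : ∀ x, f^[Q] x = x) :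
    Function.Injective f := by
  obtain ⟨n, rfl⟩ : ∃ n, Q = n + 1 := ⟨Q - 1, by have := NeZero.pos Q; omega⟩
  intro x y h
  rw [← hf x, ← hf y, Function.iterate_succ_apply, Function.iterate_succ_apply, h]

section Twist

variable {V W : Type} {Q M : ℕ} (f : V → V) (g : W → W) (a : V → ZMod Q) (b : W → ZMod Q)
  (φ : ZMod Q →+* ZMod M)

/-- The total rank modulo `M` of a pair. -/
def twistGrade (p : V × W) : ZMod M := φ (a p.1 + b p.2)

/-- One step in the first factor, then `M - 1` steps in the second one, and so on. -/
def twist (p : V × W) : V × W := if twistGrade a b φ p = 0 then (f p.1, p.2) else (p.1, g p.2)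

/-- The rank of a pair along the twisted walk. -/
def twistRank (p : V × W) : ZMod (M * Q) :=
  (M : ZMod (M * Q)) * (a p.1).val - (-twistGrade a b φ p).val

/-- A function that separates the closed twisted walks. -/
def twistInvariant (p : V × W) : ZMod Q :=
  b p.2 - (M - 1 : ZMod Q) * a p.1 + (-twistGrade a b φ p).val

variable {f g a b φ}

theorem twistGrade_fst (ha : ∀ x, a (f x) = a x + 1) (p : V × W) :
    twistGrade a b φ (f p.1, p.2) = twistGrade a b φ p + 1 := by
  unfold twistGrade
  rw [ha, add_right_comm, map_add φ _ 1, map_one]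

theorem twistGrade_snd (hb : ∀ y, b (g y) = b y + 1) (p : V × W) :
    twistGrade a b φ (p.1, g p.2) = twistGrade a b φ p + 1 := by
  unfold twistGrade
  rw [hb, ← add_assoc, map_add φ _ 1, map_one]

theorem twistGrade_twist (ha : ∀ x, a (f x) = a x + 1) (hb : ∀ y, b (g y) = b y + 1) (p : V × W) :
    twistGrade a b φ (twist f g a b φ p) = twistGrade a b φ p + 1 := by
  unfold twist
  split_ifs
  · exact twistGrade_fst ha p
  · exact twistGrade_snd hb p

theorem val_neg_one_cast (R : Type) [Ring R] [NeZero M] :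
    (((-1 : ZMod M).val : ℕ) : R) = M - 1 := by
  obtain ⟨n, rfl⟩ : ∃ n, M = n + 1 := ⟨M - 1, by have := NeZero.pos M; omega⟩
  rw [ZMod.val_neg_one, Nat.cast_succ, add_sub_cancel_right]

theorem val_neg_cast_of_ne_zero (R : Type) [Ring R] [NeZero M] {s : ZMod M} (hs : s ≠ 0) :
    (((-s).val : ℕ) : R) = ((-(s + 1)).val : ℕ) + 1 := by
  have h := zmod_val_add_one (-(s + 1))
  rw [if_neg (by simpa using hs), neg_add, neg_add_cancel_right, ← neg_add] at h
  rw [h]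
  push_cast
  rfl

theorem twistRank_twist [NeZero M] [NeZero Q] (ha : ∀ x, a (f x) = a x + 1)
    (hb : ∀ y, b (g y) = b y + 1) (p : V × W) :
    twistRank a b φ (twist f g a b φ p) = twistRank a b φ p + 1 := by
  unfold twistRank
  rw [twistGrade_twist ha hb]
  unfold twist
  split_ifs with h
  -- When the representative wraps from `Q - 1` to `0`, the discrepancy is `M * Q`, which vanishes.
  · have h1 : (M : ZMod (M * Q)) * ((a p.1 + 1).val : ℕ) = M * ((a p.1).val : ℕ) + M := by
      rw [zmod_val_add_one]
      split_ifs with h2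
      · rw [h2, val_neg_one_cast]
        have := ZMod.natCast_self (M * Q)
        push_cast at this ⊢
        linear_combination -this
      · push_cast
        ring
    simp only [ha, h1, h, zero_add, neg_zero, ZMod.val_zero, val_neg_one_cast]
    push_cast
    ring
  · simp only [val_neg_cast_of_ne_zero (ZMod (M * Q)) h]
    ring

theorem twist_iterate (m : ℕ) (p : V × W) :
    ∃ A B, A + B = m ∧ (twist f g a b φ)^[m] p = (f^[A] p.1, g^[B] p.2) := by
  induction m with
  | zero => exact ⟨0, 0, rfl, rfl⟩
  | succ m ih =>
    obtain ⟨A, B, h, hp⟩ := ih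
    rw [Function.iterate_succ_apply', hp]
    unfold twist
    split_ifs
    · exact ⟨A + 1, B, by omega, by rw [Function.iterate_succ_apply']⟩
    · exact ⟨A, B + 1, by omega, by rw [Function.iterate_succ_apply' g]⟩

/-- Rank and grade return after `M * Q` steps, hence so does the first coordinate's rank modulo `Q`.
The number of steps in the first factor is therefore a multiple of `Q`, and so is the number in the
second. -/
theorem twist_iterate_period [NeZero M] [NeZero Q] (ha : ∀ x, a (f x) = a x + 1)
    (hb : ∀ y, b (g y) = b y + 1) (hf : ∀ x, f^[Q] x = x) (hg : ∀ y, g^[Q] y = y) (p : V × W) :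
    (twist f g a b φ)^[M * Q] p = p := by
  have h1 := iterate_add_one (twistRank_twist (φ := φ) ha hb) (M * Q) p
  have h2 := iterate_add_one (twistGrade_twist (φ := φ) ha hb) (M * Q) p
  rw [ZMod.natCast_self, add_zero] at h1
  rw [Nat.cast_mul, ZMod.natCast_self, zero_mul, add_zero] at h2
  unfold twistRank at h1
  rw [h2, sub_left_inj] at h1
  obtain ⟨A, B, hAB, hp⟩ := twist_iterate (f := f) (g := g) (a := a) (b := b) (φ := φ) (M * Q) p
  rw [hp] at h1 ⊢
  rw [iterate_add_one ha, ← Nat.cast_mul, ← Nat.cast_mul, ZMod.natCast_eq_natCast_iff] at h1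
  have h3 := Nat.ModEq.mul_left_cancel' (NeZero.ne M) h1
  rw [← ZMod.natCast_eq_natCast_iff, ZMod.natCast_zmod_val, ZMod.natCast_zmod_val, add_eq_left,
    ZMod.natCast_eq_zero_iff] at h3
  have h4 : Q ∣ B := (Nat.dvd_add_right h3).1 (hAB ▸ Dvd.intro_left M rfl)
  rw [iterate_eq_of_dvd hf h3, iterate_eq_of_dvd hg h4]

theorem twistInvariant_twist [NeZero M] (ha : ∀ x, a (f x) = a x + 1)
    (hb : ∀ y, b (g y) = b y + 1) (p : V × W) :
    twistInvariant a b φ (twist f g a b φ p) = twistInvariant a b φ p := by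
  unfold twistInvariant
  rw [twistGrade_twist ha hb]
  unfold twist
  split_ifs with h
  · simp only [ha, h, zero_add, neg_zero, ZMod.val_zero, val_neg_one_cast]
    push_cast
    ring
  · simp only [hb, val_neg_cast_of_ne_zero (ZMod Q) h]
    ring

/-- Making the opposite choice changes the invariant by `M` or `-M`, nonzero in `ZMod Q` since `0 <
M < Q`. Edges of the complementary factor therefore leave the cycle they start on. -/
theorem twistInvariant_ne [NeZero M] (hMQ : M < Q) (ha : ∀ x, a (f x) = a x + 1)
    (hb : ∀ y, b (g y) = b y + 1) (p : V × W) :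
    twistInvariant a b φ (if twistGrade a b φ p = 0 then (p.1, g p.2) else (f p.1, p.2)) ≠
      twistInvariant a b φ p := by
  have hM : (M : ZMod Q) ≠ 0 := by
    rw [Ne, ZMod.natCast_eq_zero_iff]
    exact fun h => absurd (Nat.le_of_dvd (NeZero.pos M) h) (by omega)
  intro h
  apply hM
  unfold twistInvariant at h
  split_ifs at h with h0
  · simp only [twistGrade_snd hb, hb, h0, zero_add, neg_zero, ZMod.val_zero, val_neg_one_cast] at h
    push_cast at h
    linear_combination h
  · simp only [twistGrade_fst ha, ha, val_neg_cast_of_ne_zero (ZMod Q) h0] at h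
    linear_combination -h

end Twist

/-! ### Factorizations of cubes into cycles of 2-power length -/

/-- A decomposition of the graph with moves `s` into `2`-factors indexed by `T`, with oriented
cycles of length `Q` that are compatible with a rank function. -/
structure Factorization {V ι : Type} (s : ι → V → V) (T : Type) (Q : ℕ) where
  dir : T → V → ι
  rank : T → V → ZMod Q
  rank_step : ∀ τ v, rank τ (s (dir τ v) v) = rank τ v + 1
  iterate_step : ∀ τ v, (fun v => s (dir τ v) v)^[Q] v = v
  cover : ∀ v i, ∃! ω : V × T, dir ω.2 ω.1 = i ∧ (ω.1 = v ∨ ω.1 = s i v)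

section Factorizations

variable {V W V' ι κ ι' T T' : Type} {s : ι → V → V} {t : κ → W → W} {s' : ι' → V' → V'} {Q M : ℕ}

/-- The next vertex along a factor. -/
def Factorization.step (C : Factorization s T Q) (τ : T) (v : V) : V := s (C.dir τ v) v

/-- The cycles of a factorization. -/
def Factorization.toCycleSystem (C : Factorization s T Q) : CycleSystem s T Q where
  dir ω := C.dir ω.2 ω.1
  next ω := (C.step ω.2 ω.1, ω.2)
  next_fst _ := rfl
  iterate_next ω := by
    rw [iterate_semiconj (φ := fun v => (v, ω.2)) (f := C.step ω.2) (fun _ => rfl) Q ω.1]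
    exact Prod.ext (C.iterate_step ω.2 ω.1) rfl
  simple ω m hm hm' := by
    rw [iterate_semiconj (φ := fun v => (v, ω.2)) (f := C.step ω.2) (fun _ => rfl) m ω.1]
    exact iterate_ne_of_counter (C.rank_step ω.2) hm hm' ω.1
  cover := C.cover

/-- Renaming vertices, moves and factors. -/
def Factorization.map (C : Factorization s T Q) (e : V ≃ V') (f : ι ≃ ι') (g : T ≃ T')
    (h : ∀ i v, e (s i v) = s' (f i) (e v)) : Factorization s' T' Q where
  dir τ v := f (C.dir (g.symm τ) (e.symm v))
  rank τ v := C.rank (g.symm τ) (e.symm v)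
  rank_step τ v := by
    obtain ⟨v, rfl⟩ := e.surjective v
    rw [e.symm_apply_apply, ← h, e.symm_apply_apply]
    exact C.rank_step _ v
  iterate_step τ v := by
    obtain ⟨v, rfl⟩ := e.surjective v
    rw [iterate_semiconj (φ := e) (f := C.step (g.symm τ))
      (fun x => by rw [e.symm_apply_apply, ← h]; rfl) Q v]
    exact congrArg e (C.iterate_step _ v)
  cover v i := by
    obtain ⟨v, rfl⟩ := e.surjective v
    obtain ⟨i, rfl⟩ := f.surjective i
    refine existsUnique_map (e.prodCongr g) (fun ω => ?_) (C.cover v i)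
    rw [equiv_step_eq_iff h]
    simp

/-- Disjoint union of the factorizations of the two factors of a product. -/
def Factorization.prod (C : Factorization s T Q) (D : Factorization t T' Q) :
    Factorization (prodStep s t) (T ⊕ T') Q where
  dir := Sum.elim (fun τ p => Sum.inl (C.dir τ p.1)) (fun τ p => Sum.inr (D.dir τ p.2))
  rank := Sum.elim (fun τ p => C.rank τ p.1) (fun τ p => D.rank τ p.2)
  rank_step := by
    rintro (τ | τ) p
    · exact C.rank_step τ p.1
    · exact D.rank_step τ p.2
  iterate_step := by
    rintro (τ | τ) ⟨x, y⟩
    · exact (iterate_semiconj (φ := fun x => (x, y)) (f := C.step τ) (fun _ => rfl) Q x).trans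
        (Prod.ext (C.iterate_step τ x) rfl)
    · exact (iterate_semiconj (φ := fun y => (x, y)) (f := D.step τ) (fun _ => rfl) Q y).trans
        (Prod.ext rfl (D.iterate_step τ y))
  cover := by
    rintro ⟨x, y⟩ (i | i)
    · obtain ⟨⟨x', τ⟩, ⟨h1, h2⟩, hu⟩ := C.cover x i
      refine ⟨((x', y), Sum.inl τ), ⟨congrArg Sum.inl h1,
        h2.imp (fun h => Prod.ext h rfl) (fun h => Prod.ext h rfl)⟩, ?_⟩
      rintro ⟨⟨x'', y'⟩, τ' | τ'⟩ ⟨h3, h4⟩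
      · obtain rfl : y' = y :=
          h4.elim (fun h => congrArg Prod.snd h) (fun h => congrArg Prod.snd h)
        have := hu (x'', τ') ⟨Sum.inl.inj h3,
          h4.imp (fun h => congrArg Prod.fst h) (fun h => congrArg Prod.fst h)⟩
        rw [Prod.mk.injEq] at this
        rw [this.1, this.2]
      · cases h3
    · obtain ⟨⟨y', τ⟩, ⟨h1, h2⟩, hu⟩ := D.cover y i
      refine ⟨((x, y'), Sum.inr τ), ⟨congrArg Sum.inr h1,
        h2.imp (fun h => Prod.ext rfl h) (fun h => Prod.ext rfl h)⟩, ?_⟩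
      rintro ⟨⟨x', y''⟩, τ' | τ'⟩ ⟨h3, h4⟩
      · cases h3
      · obtain rfl : x' = x :=
          h4.elim (fun h => congrArg Prod.fst h) (fun h => congrArg Prod.fst h)
        have := hu (y'', τ') ⟨Sum.inr.inj h3,
          h4.imp (fun h => congrArg Prod.snd h) (fun h => congrArg Prod.snd h)⟩
        rw [Prod.mk.injEq] at this
        rw [this.1, this.2]

/-- The moves of the two factors into which a product of two cycles splits. -/
def torusDir (C : Factorization s T Q) (D : Factorization t T Q) (φ : ZMod Q →+* ZMod M)
    (τ : T × Bool) (p : V × W) : ι ⊕ κ :=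
  if τ.2 = decide (twistGrade (C.rank τ.1) (D.rank τ.1) φ p = 0) then Sum.inr (D.dir τ.1 p.2)
  else Sum.inl (C.dir τ.1 p.1)

theorem prodStep_torusDir_false (C : Factorization s T Q) (D : Factorization t T Q)
    (φ : ZMod Q →+* ZMod M) (τ : T) (p : V × W) :
    prodStep s t (torusDir C D φ (τ, false) p) p =
      twist (C.step τ) (D.step τ) (C.rank τ) (D.rank τ) φ p := by
  unfold torusDir twist
  by_cases h : twistGrade (C.rank τ) (D.rank τ) φ p = 0 <;> simp [h, prodStep, Factorization.step]

theorem prodStep_torusDir_true (C : Factorization s T Q) (D : Factorization t T Q)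
    (φ : ZMod Q →+* ZMod M) (τ : T) (p : V × W) :
    prodStep s t (torusDir C D φ (τ, true) p) p =
      if twistGrade (C.rank τ) (D.rank τ) φ p = 0 then (p.1, D.step τ p.2)
        else (C.step τ p.1, p.2) := by
  unfold torusDir
  by_cases h : twistGrade (C.rank τ) (D.rank τ) φ p = 0 <;> simp [h, prodStep, Factorization.step]

/-- The grade is symmetric in the two coordinates, so the complementary factor is again a twist with
the roles exchanged. -/
theorem prodStep_torusDir_true_swap (C : Factorization s T Q) (D : Factorization t T Q)
    (φ : ZMod Q →+* ZMod M) (τ : T) (p : W × V) :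
    prodStep s t (torusDir C D φ (τ, true) p.swap) p.swap =
      (twist (D.step τ) (C.step τ) (D.rank τ) (C.rank τ) φ p).swap := by
  have h : twistGrade (C.rank τ) (D.rank τ) φ p.swap =
      twistGrade (D.rank τ) (C.rank τ) φ p := by
    unfold twistGrade
    rw [Prod.fst_swap, Prod.snd_swap, add_comm]
  rw [prodStep_torusDir_true, h]
  unfold twist
  split_ifs <;> rfl

/-- Each torus in a product of two factorizations splits into two factors with cycles `M` times
as long. -/
def Factorization.torus [NeZero Q] [NeZero M] (C : Factorization s T Q) (D : Factorization t T Q)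
    (φ : ZMod Q →+* ZMod M) : Factorization (prodStep s t) (T × Bool) (M * Q) where
  dir := torusDir C D φ
  rank
    | (τ, false), p => twistRank (C.rank τ) (D.rank τ) φ p
    | (τ, true), p => twistRank (D.rank τ) (C.rank τ) φ p.swap
  rank_step := by
    rintro ⟨τ, _ | _⟩ p
    · rw [prodStep_torusDir_false]
      exact twistRank_twist (C.rank_step τ) (D.rank_step τ) p
    · obtain ⟨p, rfl⟩ := Prod.swap_surjective p
      rw [prodStep_torusDir_true_swap]
      simp only [Prod.swap_swap]
      exact twistRank_twist (D.rank_step τ) (C.rank_step τ) p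
  iterate_step := by
    rintro ⟨τ, _ | _⟩ p
    · simp only [prodStep_torusDir_false]
      exact twist_iterate_period (C.rank_step τ) (D.rank_step τ) (C.iterate_step τ)
        (D.iterate_step τ) p
    · obtain ⟨p, rfl⟩ := Prod.swap_surjective p
      rw [iterate_semiconj (φ := Prod.swap)
        (fun p => (prodStep_torusDir_true_swap C D φ τ p).symm) (M * Q) p]
      exact congrArg Prod.swap (twist_iterate_period (D.rank_step τ) (C.rank_step τ)
        (D.iterate_step τ) (C.iterate_step τ) p)
  cover := by
    have hinl : ∀ τ β p i, torusDir C D φ (τ, β) p = Sum.inl i ↔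
        C.dir τ p.1 = i ∧ β = !decide (twistGrade (C.rank τ) (D.rank τ) φ p = 0) := by
      intro τ β p i
      unfold torusDir
      by_cases h : twistGrade (C.rank τ) (D.rank τ) φ p = 0 <;> cases β <;> simp [h]
    have hinr : ∀ τ β p i, torusDir C D φ (τ, β) p = Sum.inr i ↔
        D.dir τ p.2 = i ∧ β = decide (twistGrade (C.rank τ) (D.rank τ) φ p = 0) := by
      intro τ β p i
      unfold torusDir
      by_cases h : twistGrade (C.rank τ) (D.rank τ) φ p = 0 <;> cases β <;> simp [h]
    rintro ⟨x, y⟩ (i | i)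
    · obtain ⟨⟨x', τ⟩, ⟨h1, h2⟩, hu⟩ := C.cover x i
      refine ⟨((x', y), τ, !decide (twistGrade (C.rank τ) (D.rank τ) φ (x', y) = 0)),
        ⟨(hinl _ _ _ _).2 ⟨h1, rfl⟩,
        h2.imp (fun h => Prod.ext h rfl) (fun h => Prod.ext h rfl)⟩, ?_⟩
      rintro ⟨⟨x'', y'⟩, τ', β⟩ ⟨h3, h4⟩
      obtain ⟨h3, h5⟩ := (hinl _ _ _ _).1 h3
      obtain rfl : y' = y :=
        h4.elim (fun h => congrArg Prod.snd h) (fun h => congrArg Prod.snd h)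
      have := hu (x'', τ') ⟨h3,
        h4.imp (fun h => congrArg Prod.fst h) (fun h => congrArg Prod.fst h)⟩
      rw [Prod.mk.injEq] at this
      obtain ⟨rfl, rfl⟩ := this
      simp only at h5
      rw [h5]
    · obtain ⟨⟨y', τ⟩, ⟨h1, h2⟩, hu⟩ := D.cover y i
      refine ⟨((x, y'), τ, decide (twistGrade (C.rank τ) (D.rank τ) φ (x, y') = 0)),
        ⟨(hinr _ _ _ _).2 ⟨h1, rfl⟩,
        h2.imp (fun h => Prod.ext rfl h) (fun h => Prod.ext rfl h)⟩, ?_⟩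
      rintro ⟨⟨x', y''⟩, τ', β⟩ ⟨h3, h4⟩
      obtain ⟨h3, h5⟩ := (hinr _ _ _ _).1 h3
      obtain rfl : x' = x :=
        h4.elim (fun h => congrArg Prod.fst h) (fun h => congrArg Prod.fst h)
      have := hu (y'', τ') ⟨h3,
        h4.imp (fun h => congrArg Prod.snd h) (fun h => congrArg Prod.snd h)⟩
      rw [Prod.mk.injEq] at this
      obtain ⟨rfl, rfl⟩ := this
      simp only at h5
      rw [h5]

end Factorizations

/-- The cube of dimension `d` has a factorization into `t` factors with cycles of length `Q`. -/
def HasFactors (Q d t : ℕ) : Prop := Nonempty (Factorization (cubeStep (Fin d)) (Fin t) Q)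

theorem HasFactors.of_system {ι T : Type} [Fintype ι] [DecidableEq ι] [Fintype T] {Q d t : ℕ}
    (C : Factorization (cubeStep ι) T Q) (hd : Fintype.card ι = d) (ht : Fintype.card T = t) :
    HasFactors Q d t :=
  ⟨C.map _ (Fintype.equivFinOfCardEq hd) (Fintype.equivFinOfCardEq ht) (cubeStep_arrowCongr _)⟩

theorem HasFactors.of_prod {ι κ T : Type} [Fintype ι] [DecidableEq ι] [Fintype κ] [DecidableEq κ]
    [Fintype T] {Q d t : ℕ} (C : Factorization (prodStep (cubeStep ι) (cubeStep κ)) T Q)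
    (hd : Fintype.card ι + Fintype.card κ = d) (ht : Fintype.card T = t) : HasFactors Q d t :=
  .of_system (C.map _ (Equiv.refl _) (Equiv.refl _) cubeStep_sumArrow)
    (by rw [Fintype.card_sum, hd]) ht

/-- The square is a single 4-cycle, ranked in Gray code order 00, 10, 11, 01. -/
theorem hasFactors_four_two_one : HasFactors 4 2 1 :=
  ⟨{ dir := fun _ v => if v 0 = v 1 then 0 else 1
     rank := fun _ v => if v 0 then (if v 1 then 2 else 1) else (if v 1 then 3 else 0)
     rank_step := by decide
     iterate_step := by decide
     cover := by unfold ExistsUnique; decide }⟩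

/-- Doubling the dimension keeps short cycles by taking a plain product. Longer ones come from
Hamiltonian cycles of the half cube, whose tori are split with `M = 2 ^ v`. -/
theorem hasFactors_two_pow (c : ℕ) (u : ℕ) (hu : 2 ≤ u) (hc : u ≤ 2 ^ (c + 1)) :
    HasFactors (2 ^ u) (2 ^ (c + 1)) (2 ^ c) := by
  induction c generalizing u with
  | zero =>
    obtain rfl : u = 2 := by omega
    exact hasFactors_four_two_one
  | succ c ih =>
    have h2 : 2 ≤ 2 ^ (c + 1) := by
      rw [pow_succ]
      have : 0 < 2 ^ c := by positivity
      omega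
    rcases Nat.lt_or_ge (2 ^ (c + 1)) u with h | h
    · obtain ⟨C⟩ := ih (2 ^ (c + 1)) h2 le_rfl
      obtain ⟨v, hv⟩ : ∃ v, u = v + 2 ^ (c + 1) := ⟨u - 2 ^ (c + 1), by omega⟩
      have hdvd : 2 ^ v ∣ 2 ^ 2 ^ (c + 1) := pow_dvd_pow 2 (by rw [pow_succ] at hc; omega)
      rw [hv, pow_add]
      exact .of_prod (C.torus C (ZMod.castHom hdvd _)) (by simp; ring) (by simp; ring)
    · obtain ⟨C⟩ := ih u hu h
      exact .of_prod (C.prod C) (by simp; ring) (by simp; ring)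

/-! ### Orientations with paired outgoing edges -/

/-- An orientation of the graph with moves `s` whose outgoing edges come in pairs: the pairs that
leave a vertex are indexed by the active elements of `T`. -/
structure PairOrientation {Z ι : Type} (s : ι → Z → Z) (T : Type) where
  active : Z → T → Prop
  out : ∀ z (τ : T × Bool), active z τ.1 → ι
  cover : ∀ z i, ∃! ω : Z × T × Bool, (∃ h, out ω.1 ω.2 h = i) ∧ (ω.1 = z ∨ ω.1 = s i z)

section PairOrientations

variable {Z Z' ι ι' T T' : Type} {s : ι → Z → Z} {s' : ι' → Z' → Z'}

/-- Renaming vertices, moves and indices. -/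
def PairOrientation.map (E : PairOrientation s T) (e : Z ≃ Z') (f : ι ≃ ι') (g : T ≃ T')
    (h : ∀ i z, e (s i z) = s' (f i) (e z)) : PairOrientation s' T' where
  active z τ := E.active (e.symm z) (g.symm τ)
  out z τ h := f (E.out (e.symm z) (g.symm τ.1, τ.2) h)
  cover z i := by
    obtain ⟨z, rfl⟩ := e.surjective z
    obtain ⟨i, rfl⟩ := f.surjective i
    refine existsUnique_map (e.prodCongr (g.prodCongr (Equiv.refl Bool))) (fun ω => ?_)
      (E.cover z i)
    rw [equiv_step_eq_iff h]
    simp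

/-- The orientation of a product given by orientations of its factors. -/
def PairOrientation.prod (E : PairOrientation s T) (E' : PairOrientation s' T') :
    PairOrientation (prodStep s s') (T ⊕ T') where
  active z := Sum.elim (E.active z.1) (E'.active z.2)
  out
    | z, (Sum.inl τ, β), h => Sum.inl (E.out z.1 (τ, β) h)
    | z, (Sum.inr τ, β), h => Sum.inr (E'.out z.2 (τ, β) h)
  cover := by
    rintro ⟨x, y⟩ (i | i)
    · obtain ⟨⟨x', τ, β⟩, ⟨⟨h0, h1⟩, h2⟩, hu⟩ := E.cover x i
      refine ⟨((x', y), Sum.inl τ, β), ⟨⟨h0, congrArg Sum.inl h1⟩,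
        h2.imp (fun h => Prod.ext h rfl) (fun h => Prod.ext h rfl)⟩, ?_⟩
      rintro ⟨⟨x'', y'⟩, τ' | τ', β'⟩ ⟨⟨h3, h4⟩, h5⟩
      · obtain rfl : y' = y :=
          h5.elim (fun h => congrArg Prod.snd h) (fun h => congrArg Prod.snd h)
        have := hu (x'', τ', β') ⟨⟨h3, Sum.inl.inj h4⟩,
          h5.imp (fun h => congrArg Prod.fst h) (fun h => congrArg Prod.fst h)⟩
        simp only [Prod.mk.injEq] at this
        rw [this.1, this.2.1, this.2.2]
      · cases h4
    · obtain ⟨⟨y', τ, β⟩, ⟨⟨h0, h1⟩, h2⟩, hu⟩ := E'.cover y i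
      refine ⟨((x, y'), Sum.inr τ, β), ⟨⟨h0, congrArg Sum.inr h1⟩,
        h2.imp (fun h => Prod.ext rfl h) (fun h => Prod.ext rfl h)⟩, ?_⟩
      rintro ⟨⟨x', y''⟩, τ' | τ', β'⟩ ⟨⟨h3, h4⟩, h5⟩
      · cases h4
      · obtain rfl : x' = x :=
          h5.elim (fun h => congrArg Prod.fst h) (fun h => congrArg Prod.fst h)
        have := hu (y'', τ', β') ⟨⟨h3, Sum.inr.inj h4⟩,
          h5.imp (fun h => congrArg Prod.snd h) (fun h => congrArg Prod.snd h)⟩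
        simp only [Prod.mk.injEq] at this
        rw [this.1, this.2.1, this.2.2]

end PairOrientations

/-- The cube of dimension `d` has an orientation with outgoing edges in `t` possible pairs. -/
def HasPairOrientation (d t : ℕ) : Prop :=
  Nonempty (PairOrientation (cubeStep (Fin d)) (Fin t))

theorem HasPairOrientation.of_system {ι T : Type} [Fintype ι] [DecidableEq ι] [Fintype T]
    {d t : ℕ} (E : PairOrientation (cubeStep ι) T) (hd : Fintype.card ι = d)
    (ht : Fintype.card T = t) : HasPairOrientation d t :=
  ⟨E.map _ (Fintype.equivFinOfCardEq hd) (Fintype.equivFinOfCardEq ht) (cubeStep_arrowCongr _)⟩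

theorem HasPairOrientation.add {a b t t' : ℕ} : HasPairOrientation a t →
    HasPairOrientation b t' → HasPairOrientation (a + b) (t + t') :=
  fun ⟨E⟩ ⟨E'⟩ => .of_system
    ((E.prod E').map _ (Equiv.refl _) (Equiv.refl _) cubeStep_sumArrow) (by simp) (by simp)

theorem hasPairOrientation_zero (t : ℕ) : HasPairOrientation 0 t :=
  ⟨{ active := fun _ _ => False
     out := fun _ _ h => h.elim
     cover := fun _ i => i.elim0 }⟩

/-- All four edges of the square leave the two even words. -/
theorem hasPairOrientation_two : HasPairOrientation 2 1 :=
  .of_system (ι := Bool) (T := Unit)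
    { active := fun z _ => z false = z true
      out := fun _ τ _ => τ.2
      cover := by unfold ExistsUnique; decide } rfl rfl

/-- The coordinates form two squares, each oriented cyclically; every word has one outgoing edge in
each, and these form its pair. -/
theorem hasPairOrientation_four : HasPairOrientation 4 1 :=
  .of_system (ι := Bool × Bool) (T := Unit)
    { active := fun _ _ => True
      out := fun z τ _ => (τ.2, xor (z (τ.2, false)) (z (τ.2, true)))
      cover := by
        rintro z ⟨β, ε⟩
        have key : ∀ w : Bool × Bool → Bool, xor (cubeStep _ (β, ε) w (β, false))
            (cubeStep _ (β, ε) w (β, true)) = !xor (w (β, false)) (w (β, true)) := by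
          intro w
          cases ε <;> simp [cubeStep_apply]
        by_cases h : xor (z (β, false)) (z (β, true)) = ε
        · refine ⟨(z, (), β), ⟨⟨trivial, Prod.ext rfl h⟩, Or.inl rfl⟩, ?_⟩
          rintro ⟨z', ⟨⟩, β'⟩ ⟨⟨-, h1⟩, h2⟩
          obtain ⟨h3, h4⟩ := Prod.mk.inj h1
          simp only at h4 h2 h3
          subst h3
          rcases h2 with rfl | h2
          · rfl
          · obtain rfl : z' = _ := h2
            rw [key, h] at h4
            cases ε <;> cases h4
        · refine ⟨(cubeStep _ (β, ε) z, (), β), ⟨⟨trivial, Prod.ext rfl ?_⟩, Or.inr rfl⟩, ?_⟩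
          · simp only [key]
            revert h
            cases xor (z (β, false)) (z (β, true)) <;> cases ε <;> simp
          · rintro ⟨z', ⟨⟩, β'⟩ ⟨⟨-, h1⟩, h2⟩
            obtain ⟨h3, h4⟩ := Prod.mk.inj h1
            simp only at h4 h2 h3
            subst h3
            rcases h2 with rfl | h2
            · exact absurd h4 h
            · rw [show z' = _ from h2] } rfl rfl

theorem hasPairOrientation_even (t r : ℕ) (hr : r ≤ 2 * t) : HasPairOrientation (2 * r) t := by
  induction t generalizing r with
  | zero =>
    obtain rfl : r = 0 := by omega
    exact hasPairOrientation_zero 0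
  | succ t ih =>
    rcases Nat.lt_or_ge r 2 with h | h
    · have h0 : HasPairOrientation 0 t := hasPairOrientation_zero t
      interval_cases r
      · exact hasPairOrientation_zero (t + 1)
      · exact h0.add hasPairOrientation_two
    · have := (ih (r - 2) (by omega)).add hasPairOrientation_four
      rwa [show 2 * (r - 2) + 4 = 2 * r by omega] at this

/-! ### Sunlets from split tori and the final theorem -/

section Assembly

variable {V W Z ι κ μ T : Type} {s : ι → V → V} {t : κ → W → W} {r : μ → Z → Z} {Q M : ℕ}

open Classical in
/-- Sunlets in the product of two factorized graphs with a graph with paired outgoing edges. The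
tori split into two factors; the second one gives the pendant edges of the first one, except where
both have pendant edges in the third graph. -/
noncomputable def torusSunlets [NeZero Q] [NeZero M] (hMQ : M < Q) (C : Factorization s T Q)
    (D : Factorization t T Q) (φ : ZMod Q →+* ZMod M) (E : PairOrientation r T)
    (hr : ∀ i z, r i z ≠ z) :
    SunletSystem (prodStep (prodStep s t) r) (M * Q) :=
  let F := C.torus D φ
  have hL : M * Q ≠ 0 := mul_ne_zero (NeZero.ne M) (NeZero.ne Q)
  have : NeZero (M * Q) := ⟨hL⟩
  let State := (V × W) × {ω : Z × T × Bool // ω.2.2 = true → E.active ω.1 ω.2.1}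
  let next : State → State := fun ω => (F.step ω.2.1.2 ω.1, ω.2)
  have hnext : ∀ m ω, next^[m] ω = ((F.step ω.2.1.2)^[m] ω.1, ω.2) := fun m ω =>
    iterate_semiconj (φ := fun v => (v, ω.2)) (f := F.step ω.2.1.2) (fun _ => rfl) m ω.1
  have hsimple : ∀ ω : State, ∀ m, 0 < m → m < M * Q → (F.step ω.2.1.2)^[m] ω.1 ≠ ω.1 :=
    fun ω m hm hm' => iterate_ne_of_counter (F.rank_step _) hm hm' ω.1
  { State := State
    pos := fun ω => (ω.1, ω.2.1.1)
    next := next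
    dir := fun ω => Sum.inl (F.dir ω.2.1.2 ω.1)
    out := fun ω => if h : E.active ω.2.1.1 ω.2.1.2.1 then Sum.inr (E.out ω.2.1.1 ω.2.1.2 h)
      else Sum.inl (F.dir (ω.2.1.2.1, true) ω.1)
    pos_next := fun _ => rfl
    iterate_next := fun ω => by
      rw [hnext]
      exact Prod.ext (F.iterate_step _ _) rfl
    simple := fun ω m hm hm' h => by
      rw [hnext] at h
      exact hsimple ω m hm hm' (congrArg Prod.fst h :)
    out_not_mem := by
      rintro ⟨p, ⟨⟨z, τ, β⟩, hβ⟩⟩ m h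
      rw [hnext] at h
      split_ifs at h with ha
      · exact hr _ _ (congrArg Prod.snd h).symm
      · obtain rfl : β = false := by
          cases β
          · rfl
          · exact absurd (hβ rfl) ha
        have h' : (F.step (τ, false))^[m] p =
            prodStep s t (torusDir C D φ (τ, true) p) p := congrArg Prod.fst h
        rw [prodStep_torusDir_true] at h'
        refine twistInvariant_ne (φ := φ) hMQ (C.rank_step τ) (D.rank_step τ) p ?_
        -- If the pendant end were on the cycle, it would share the invariant of `p`.
        change twistInvariant _ _ _ (if _ then (p.1, D.step τ p.2) else (C.step τ p.1, p.2)) = _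
        rw [← h']
        refine iterate_invariant (fun p => ?_) m p
        change twistInvariant _ _ _ (prodStep s t (torusDir C D φ (τ, false) p) p) = _
        rw [prodStep_torusDir_false]
        exact twistInvariant_twist (C.rank_step τ) (D.rank_step τ) p
    out_simple := by
      rintro ⟨p, ⟨⟨z, τ, β⟩, hβ⟩⟩ m hm hm' h
      rw [hnext] at h
      refine hsimple (p, ⟨⟨z, τ, β⟩, hβ⟩) m hm hm' ?_
      by_cases ha : E.active z τ
      · simp only [ha, dite_true] at h
        exact (congrArg Prod.fst h :)
      · simp only [ha, dite_false] at h
        exact injective_of_iterate (F.iterate_step (τ, true)) (congrArg Prod.fst h :)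
    cover := by
      rintro ⟨p, z⟩ (i | i)
      · obtain ⟨⟨p', τ, β⟩, ⟨h1, h2⟩, hu⟩ := F.cover p i
        -- Otherwise the edge belongs to the second factor over an inactive layer, where it is the
        -- pendant edge of the first factor's state.
        by_cases hβ : β = true → E.active z τ
        · refine ⟨Sum.inl (p', ⟨(z, τ, β), hβ⟩), ⟨congrArg Sum.inl h1,
            h2.imp (fun h => Prod.ext h rfl) (fun h => Prod.ext h rfl)⟩, ?_⟩
          rintro (⟨p'', ⟨⟨z', τ', β'⟩, hβ'⟩⟩ | ⟨p'', ⟨⟨z', τ', β'⟩, hβ'⟩⟩) ⟨h3, h4⟩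
          · obtain rfl : z' = z :=
              h4.elim (fun h => congrArg Prod.snd h) (fun h => congrArg Prod.snd h)
            have := hu (p'', τ', β') ⟨Sum.inl.inj h3,
              h4.imp (fun h => congrArg Prod.fst h) (fun h => congrArg Prod.fst h)⟩
            simp only [Prod.mk.injEq] at this
            obtain ⟨rfl, rfl, rfl⟩ := this
            rfl
          · simp only [Sum.elim_inr] at h3 h4
            split_ifs at h3 with ha
            obtain rfl : z' = z :=
              h4.elim (fun h => congrArg Prod.snd h) (fun h => congrArg Prod.snd h)
            have := hu (p'', τ', true) ⟨Sum.inl.inj h3,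
              h4.imp (fun h => congrArg Prod.fst h) (fun h => congrArg Prod.fst h)⟩
            simp only [Prod.mk.injEq] at this
            obtain ⟨rfl, rfl, rfl⟩ := this
            exact absurd (hβ rfl) ha
        · push Not at hβ
          obtain ⟨rfl, ha⟩ := hβ
          refine ⟨Sum.inr (p', ⟨(z, τ, false), fun h => by cases h⟩), ⟨?_,
            h2.imp (fun h => Prod.ext h rfl) (fun h => Prod.ext h rfl)⟩, ?_⟩
          · simp only [Sum.elim_inr, ha, dite_false]
            exact congrArg Sum.inl h1
          · rintro (⟨p'', ⟨⟨z', τ', β'⟩, hβ'⟩⟩ | ⟨p'', ⟨⟨z', τ', β'⟩, hβ'⟩⟩) ⟨h3, h4⟩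
            · obtain rfl : z' = z :=
                h4.elim (fun h => congrArg Prod.snd h) (fun h => congrArg Prod.snd h)
              have := hu (p'', τ', β') ⟨Sum.inl.inj h3,
                h4.imp (fun h => congrArg Prod.fst h) (fun h => congrArg Prod.fst h)⟩
              simp only [Prod.mk.injEq] at this
              obtain ⟨rfl, rfl, rfl⟩ := this
              exact absurd (hβ' rfl) ha
            · simp only [Sum.elim_inr] at h3 h4
              split_ifs at h3 with ha'
              obtain rfl : z' = z :=
                h4.elim (fun h => congrArg Prod.snd h) (fun h => congrArg Prod.snd h)
              have := hu (p'', τ', true) ⟨Sum.inl.inj h3,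
                h4.imp (fun h => congrArg Prod.fst h) (fun h => congrArg Prod.fst h)⟩
              simp only [Prod.mk.injEq] at this
              obtain ⟨rfl, rfl, -⟩ := this
              obtain rfl : β' = false := by
                cases β'
                · rfl
                · exact absurd (hβ' rfl) ha
              rfl
      · obtain ⟨⟨z', τ, β⟩, ⟨⟨h0, h1⟩, h2⟩, hu⟩ := E.cover z i
        refine ⟨Sum.inr (p, ⟨(z', τ, β), fun _ => h0⟩), ⟨?_,
          h2.imp (fun h => Prod.ext rfl h) (fun h => Prod.ext rfl h)⟩, ?_⟩
        · simp only at h0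
          simp only [Sum.elim_inr, h0, dite_true]
          exact congrArg Sum.inr h1
        · rintro (⟨p', ⟨⟨z'', τ', β'⟩, hβ'⟩⟩ | ⟨p', ⟨⟨z'', τ', β'⟩, hβ'⟩⟩) ⟨h3, h4⟩
          · cases h3
          · simp only [Sum.elim_inr] at h3 h4
            split_ifs at h3 with ha
            obtain rfl : p' = p :=
              h4.elim (fun h => congrArg Prod.fst h) (fun h => congrArg Prod.fst h)
            have := hu (z'', τ', β') ⟨⟨ha, Sum.inr.inj h3⟩,
              h4.imp (fun h => congrArg Prod.snd h) (fun h => congrArg Prod.snd h)⟩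
            simp only [Prod.mk.injEq] at this
            obtain ⟨rfl, rfl, rfl⟩ := this
            rfl }

end Assembly

theorem HasFactors.hasSunlets {u e a b k : ℕ} (he : e < u) : HasFactors (2 ^ u) a k →
    HasPairOrientation b k → HasSunlets (2 ^ e * 2 ^ u) (a + a + b) :=
  fun ⟨C⟩ ⟨E⟩ =>
    have h : 2 ^ e ∣ 2 ^ u := pow_dvd_pow 2 he.le
    .of_prod ((torusSunlets (pow_lt_pow_right₀ one_lt_two he) C C
      (ZMod.castHom h _) E cubeStep_ne).map
        ((Equiv.sumArrowEquivProdArrow _ _ Bool).symm.prodCongr (Equiv.refl _))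
        (Equiv.refl _) (by
          rintro (i | i) ⟨p, z⟩
          · exact Prod.ext (cubeStep_sumArrow i p) rfl
          · rfl)) (by simp)

theorem hasSunlets_two_pow {n d t : ℕ} (hd : Even d) (hn : 4 ≤ n) (hnd : 2 * n ≤ d) (ht : 2 ≤ t)
    (htn : t ≤ n - 1) : HasSunlets (2 ^ t) d := by
  obtain ⟨r, rfl⟩ := hd
  rcases Nat.eq_or_lt_of_le ht with rfl | ht
  · obtain ⟨C⟩ := hasFactors_four_two_one
    have h : HasCycles 4 (2 * 1) 1 := ⟨C.toCycleSystem⟩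
    have := h.hasSunlets_mul r (by omega)
    rwa [show r * (2 * 1) = r + r by ring] at this
  -- With `2 ^ (c + 2) ≤ d < 2 ^ (c + 3)`, two cubes of dimension `2 ^ (c + 1)` form the tori. Fewer
  -- than `4 * 2 ^ c` coordinates remain, so the `2 ^ c` pairs can absorb them.
  · have h1 : 2 ≤ Nat.log 2 (r + r) := Nat.le_log_of_pow_le one_lt_two (by omega)
    obtain ⟨c, hc⟩ : ∃ c, Nat.log 2 (r + r) = c + 2 := ⟨Nat.log 2 (r + r) - 2, by omega⟩
    have h2 : 2 ^ (c + 2) ≤ r + r := hc ▸ Nat.pow_log_le_self 2 (by omega)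
    have h3 : r + r < 2 ^ (c + 3) := by
      have := Nat.lt_pow_succ_log_self one_lt_two (r + r)
      rwa [hc] at this
    have e1 : 2 ^ (c + 1) = 2 * 2 ^ c := by ring
    have e2 : 2 ^ (c + 2) = 4 * 2 ^ c := by ring
    have e3 : 2 ^ (c + 3) = 8 * 2 ^ c := by ring
    -- Cycles of length `2 ^ u` are lengthened by the factor `2 ^ e`. The strict `e < u` needs `t <
    -- 2 ^ (c + 2)` when `u` is maximal, which follows from `2 * t < 2 * n ≤ d`.
    obtain ⟨u, e, hue, hu, huc, heu⟩ :
        ∃ u e, e + u = t ∧ 2 ≤ u ∧ u ≤ 2 ^ (c + 1) ∧ e < u := by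
      rcases Nat.lt_or_ge (2 ^ (c + 1)) (t - 1) with h | h
      · exact ⟨2 ^ (c + 1), t - 2 ^ (c + 1), by omega, by omega, le_rfl, by omega⟩
      · exact ⟨t - 1, 1, by omega, by omega, h, by omega⟩
    have := (hasFactors_two_pow c u hu huc).hasSunlets heu
      (hasPairOrientation_even (2 ^ c) (r - 2 ^ (c + 1)) (by omega))
    rwa [← pow_add, hue, show 2 ^ (c + 1) + 2 ^ (c + 1) + 2 * (r - 2 ^ (c + 1)) = r + r by omega]
      at this

theorem mainTheorem5 (m n : ℕ) (hm : 2 ≤ m) (hn : 4 ≤ n) (hn_even : Even n) :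
    (∀ t : ℕ, 2 ≤ t → t ≤ n - 1 → HasDecomposition (hypercube (m * n)) (sunletGraph (2 ^ t))) ∧
    HasDecomposition (hypercube (m * n)) (sunletGraph n) ∧
    HasDecomposition (hypercube (m * n)) (sunletGraph (2 * n)) ∧
    HasDecomposition (hypercube (m * n)) (sunletGraph (4 * n)) ∧
    (∀ k : ℕ, 2 * n ≤ n * 2 ^ k → (n : ℝ) * 2 ^ k ≤ 2 ^ n / n →
      HasDecomposition (hypercube (m * n)) (sunletGraph (n * 2 ^ k))) := by
  have main : ∀ k ≤ n, ∀ L, L = n * 2 ^ k →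
      HasDecomposition (hypercube (m * n)) (sunletGraph L) := by
    rintro k hk L rfl
    obtain ⟨S⟩ := hasSunlets_mul_of_even hm hn hn_even hk
    have : 1 ≤ 2 ^ k := Nat.one_le_two_pow
    exact S.hasDecomposition (by nlinarith)
  refine ⟨fun t ht htn => ?_, main 0 (by omega) _ (by ring), main 1 (by omega) _ (by ring),
    main 2 (by omega) _ (by ring), fun k _ hk => main k ?_ _ rfl⟩
  · obtain ⟨S⟩ := hasSunlets_two_pow (hn_even.mul_left m) hn (Nat.mul_le_mul_right n hm) ht htn
    have : 2 ^ 2 ≤ 2 ^ t := Nat.pow_le_pow_right two_pos ht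
    exact S.hasDecomposition (by omega)
  · have hn' : (4 : ℝ) ≤ n := by exact_mod_cast hn
    -- The bound on `k` enters only through `k ≤ n`, the range reached by the rotor.
    have h1 : (2 : ℝ) ^ k ≤ 2 ^ n := by
      have h2 : (2 : ℝ) ^ n / n ≤ 2 ^ n := div_le_self (by positivity) (by linarith)
      have h3 : (0 : ℝ) < 2 ^ k := by positivity
      nlinarith
    exact (pow_le_pow_iff_right₀ (by norm_num)).1 h1
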